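/- Let $D_1=\{X\in\mathbb R^2:|X|\le 1\}$ be the closed unit disc and $\mathbb S^2=\{\xi\in\mathbb R^3:|\xi|=1\}$ the unit sphere with its surface area measure (of total mass $4\pi$). Let $W^{1,2}(D_1,\mathbb S^2)$ be the set of $\mathbf n\in W^{1,2}(D_1,\mathbb R^3)$ with $\mathbf n(X)\in\mathbb S^2$ for almost every $X\in D_1$; for such $\mathbf n$, with weak derivatives $\partial_1\mathbf n,\partial_2\mathbf n\in L^2(D_1,\mathbb R^3)$, put $|\nabla\mathbf n|^2=|\partial_1\mathbf n|^2+|\partial_2\mathbf n|^2$ and $$\Phi(X)=\mathbf n(X)\cdot\big(\partial_1\mathbf n(X)\times\partial_2\mathbf n(X)\big),\qquad X\in D_1,$$ so that $\Phi\in L^1(D_1)$. Let $C_0^\infty(D_1)$ be the set of smooth real functions with compact support in the open disc $\{|X|<1\}$. Let $W^{-1,2}(D_1)$ be the dual of $W^{1,2}_0(D_1)$, the latter normed by $\zeta\mapsto\|\nabla\zeta\|_{L^2(D_1)}$; thus, for $g\in L^1(D_1)$, $$\|g\|_{W^{-1,2}(D_1)}=\sup\Big\{\Big|\int_{D_1}g\,\zeta\,dX\Big|:\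 \zeta\in C_0^\infty(D_1),\ \|\nabla\zeta\|_{L^2(D_1)}\le 1\Big\}\in[0,\infty].$$ There is an absolute constant $c>0$ such that the following holds for every $\mathbf n\in W^{1,2}(D_1,\mathbb S^2)$ (with no restriction on its energy) and every Borel set $\mathcal A\subset\mathbb S^2$ of positive surface measure $\mu$. Let $\mathcal F=\{X\in D_1:\mathbf n(X)\in\mathcal A\}$, with characteristic function $\chi_{\mathcal F}$. There exist $\Omega_1,\Omega_2\in L^2(D_1)$ with $$\|\Omega_i\|_{L^2(D_1)}\le c\,\mu^{-1/2}\,\|\nabla\mathbf n\|_{L^2(D_1)},\qquad i=1,2,$$ such that, for all $\zeta\in C_0^\infty(D_1)$, $$\int_{D_1}\Phi\,\zeta\,dX=\frac{4\pi}{\mu}\int_{\mathcal F}\Phi\,\zeta\,dX+\int_{D_1}\big(\Omega_2\,\partial_1\zeta-\Omega_1\,\partial_2\zeta\big)\,dX .$$ Moreover, $$\Big\|\Phi-\frac{4\pi}{\mu}\,\chi_{\mathcal F}\,\Phi\Big\|_{W^{-1,2}(D_1)}\le c\,\mu^{-1/2}\,\|\nabla\mathbf n\|_{L^2(D_1)}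 .$$ -/

import Mathlib

open MeasureTheory
open scoped Distributions Matrix ENNReal

/-- The plane `ℝ²` with its Euclidean norm. -/
abbrev Plane : Type := EuclideanSpace ℝ (Fin 2)

/-- Three-dimensional space `ℝ³` with its Euclidean norm. -/
abbrev Space3 : Type := EuclideanSpace ℝ (Fin 3)

/-- The unit sphere `S²` in `ℝ³`. -/
abbrev UnitSphere : Type := Metric.sphere (0 : Space3) 1

/-- The closed unit disc `D₁` of the plane. -/
def closedDisc : Set Plane := Metric.closedBall 0 1

/-- The open unit disc `D₁°`, as an open set. -/
def openDisc : TopologicalSpace.Opens Plane := ⟨Metric.ball 0 1, Metric.isOpen_ball⟩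

/-- Lebesgue measure on `D₁`. -/
noncomputable def discMeasure : Measure Plane := volume.restrict closedDisc

/-- The surface area measure on `S²`, of total mass `4π`. -/
noncomputable def sphereArea : Measure UnitSphere := (volume : Measure Space3).toSphere

/-- The area of a subset of `S²`, as a real number. -/
noncomputable def area (A : Set UnitSphere) : ℝ := (sphereArea A).toReal

/-- The classical partial derivative `∂ᵢζ` (with `∂₁`, `∂₂` at the indices `0`, `1`). -/
noncomputable def partialDeriv (i : Fin 2) (ζ : Plane → ℝ) (X : Plane) : ℝ :=
  fderiv ℝ ζ X (EuclideanSpace.single i 1)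

/-- The `L²(D₁)` norm of a function in `L²(D₁)`. -/
noncomputable def l2Norm (u : Plane → ℝ) : ℝ := (eLpNorm u 2 discMeasure).toReal

/-- The pointwise length `|∇u| = (|∂₁u|² + |∂₂u|²)^{1/2}` of a gradient `∇u = (p 0, p 1)`. -/
noncomputable def gradLength {E : Type*} [NormedAddCommGroup E] (p : Fin 2 → Plane → E)
    (X : Plane) : ℝ :=
  Real.sqrt (∑ i, ‖p i X‖ ^ 2)

/-- `n` belongs to `W^{1,2}(D₁, S²)` and `p 0`, `p 1` are (representatives of) its weak partial
derivatives `∂₁n`, `∂₂n`. -/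
structure IsW12SphereMap (n : Plane → Space3) (p : Fin 2 → Plane → Space3) : Prop where
  memLp : MemLp n 2 discMeasure
  memLp_deriv : ∀ i, MemLp (p i) 2 discMeasure
  weak_deriv : ∀ (i : Fin 2) (ζ : 𝓓(openDisc, ℝ)),
    ∫ X, partialDeriv i ζ X • n X ∂discMeasure = - ∫ X, ζ X • p i X ∂discMeasure
  norm_eq_one : ∀ᵐ X ∂discMeasure, ‖n X‖ = 1

/-- `Φ = n · (∂₁n × ∂₂n)`. -/
def areaDensity (n : Plane → Space3) (p : Fin 2 → Plane → Space3) (X : Plane) : ℝ :=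
  (n X).ofLp ⬝ᵥ ((p 0 X).ofLp ⨯₃ (p 1 X).ofLp)

/-- The pre-image `n⁻¹(A) = {X ∈ D₁ : n(X) ∈ A}` of a set `A ⊆ S²`. -/
def discPreimage (n : Plane → Space3) (A : Set UnitSphere) : Set Plane :=
  {X | X ∈ closedDisc ∧ n X ∈ ((↑) : UnitSphere → Space3) '' A}

/-- The norm in `W^{-1,2}(D₁)`, the dual of the closure `W^{1,2}_0(D₁)` of `C_0^∞(D₁)` under
`ζ ↦ ‖∇ζ‖_{L²(D₁)}`, of the functional `ζ ↦ ∫_{D₁} g ζ` given by an integrable function `g`.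
It is `∞` when this functional has no continuous extension to `W^{1,2}_0(D₁)`. -/
noncomputable def negSobolevNorm (g : Plane → ℝ) : ℝ≥0∞ :=
  ⨆ (ζ : 𝓓(openDisc, ℝ)) (_ : l2Norm (gradLength fun i => partialDeriv i ζ) ≤ 1),
    ENNReal.ofReal |∫ X, g X * ζ X ∂discMeasure|

section Mollification

open Filter Topology
open scoped Convolution

variable {G E : Type*} [NormedAddCommGroup G] [NormedSpace ℝ G] [FiniteDimensional ℝ G]
  [MeasurableSpace G] [BorelSpace G] {ν : Measure G} [ν.IsAddHaarMeasure]
  [NormedAddCommGroup E] [NormedSpace ℝ E]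

/-- Jensen's inequality for mollification. -/
theorem ContDiffBump.enorm_normed_convolution_sq_le (φ : ContDiffBump (0 : G)) {f : G → E}
    (hf : AEStronglyMeasurable f ν) (x : G) :
    ‖(φ.normed ν ⋆[ContinuousLinearMap.lsmul ℝ ℝ, ν] f) x‖ₑ ^ (2 : ℝ) ≤
      ∫⁻ t, ENNReal.ofReal (φ.normed ν t) * ‖f (x - t)‖ₑ ^ (2 : ℝ) ∂ν := by
  set w : G → ℝ≥0∞ := fun t => ENNReal.ofReal (φ.normed ν t) with hw
  have hwm : Measurable w := φ.continuous_normed.measurable.ennreal_ofReal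
  have hprob : IsProbabilityMeasure (ν.withDensity w) := by
    refine ⟨?_⟩
    rw [withDensity_apply _ MeasurableSet.univ, Measure.restrict_univ,
      ← ofReal_integral_eq_lintegral_ofReal φ.integrable_normed
        (Eventually.of_forall fun t => φ.nonneg_normed t), φ.integral_normed, ENNReal.ofReal_one]
  have hfx : AEStronglyMeasurable (fun t => f (x - t)) (ν.withDensity w) :=
    (hf.comp_quasiMeasurePreserving (quasiMeasurePreserving_sub_left ν x)).mono_ac
      (withDensity_absolutelyContinuous _ _)
  have h1 : ‖(φ.normed ν ⋆[ContinuousLinearMap.lsmul ℝ ℝ, ν] f) x‖ₑ ≤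
      eLpNorm (fun t => f (x - t)) 1 (ν.withDensity w) := by
    rw [eLpNorm_one_eq_lintegral_enorm, lintegral_withDensity_eq_lintegral_mul₀' hwm.aemeasurable
      hfx.enorm, convolution]
    refine (enorm_integral_le_lintegral_enorm _).trans (lintegral_mono fun t => ?_)
    simp only [ContinuousLinearMap.lsmul_apply, enorm_smul, Pi.mul_apply, hw]
    rw [Real.enorm_eq_ofReal (φ.nonneg_normed t)]
  have h2 := h1.trans (eLpNorm_le_eLpNorm_of_exponent_le (one_le_two) hfx)
  rw [eLpNorm_eq_lintegral_rpow_enorm_toReal two_ne_zero ENNReal.ofNat_ne_top] at h2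
  simp only [ENNReal.toReal_ofNat] at h2
  have h3 := ENNReal.rpow_le_rpow h2 (zero_le_two : (0 : ℝ) ≤ 2)
  rw [← ENNReal.rpow_mul] at h3
  norm_num at h3
  rw [lintegral_withDensity_eq_lintegral_mul₀' hwm.aemeasurable (by
    simpa using hfx.enorm.pow_const 2)] at h3
  simpa using h3

/-- Mollification is a contraction on `L²`. -/
theorem ContDiffBump.eLpNorm_normed_convolution_le (φ : ContDiffBump (0 : G)) {f : G → E}
    (hf : AEStronglyMeasurable f ν) :
    eLpNorm (φ.normed ν ⋆[ContinuousLinearMap.lsmul ℝ ℝ, ν] f) 2 ν ≤ eLpNorm f 2 ν := by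
  rw [eLpNorm_eq_lintegral_rpow_enorm_toReal two_ne_zero ENNReal.ofNat_ne_top,
    eLpNorm_eq_lintegral_rpow_enorm_toReal two_ne_zero ENNReal.ofNat_ne_top]
  refine ENNReal.rpow_le_rpow ?_ (by positivity)
  simp only [ENNReal.toReal_ofNat]
  refine (lintegral_mono fun x => φ.enorm_normed_convolution_sq_le hf x).trans ?_
  have hwm : Measurable fun t => ENNReal.ofReal (φ.normed ν t) :=
    φ.continuous_normed.measurable.ennreal_ofReal
  rw [lintegral_lintegral_swap]
  · have : ∀ t, ∫⁻ x, ENNReal.ofReal (φ.normed ν t) * ‖f (x - t)‖ₑ ^ (2 : ℝ) ∂ν =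
        ENNReal.ofReal (φ.normed ν t) * ∫⁻ x, ‖f x‖ₑ ^ (2 : ℝ) ∂ν := by
      intro t
      rw [lintegral_const_mul' _ _ ENNReal.ofReal_ne_top,
        lintegral_sub_right_eq_self (fun x => ‖f x‖ₑ ^ (2 : ℝ)) t]
    simp_rw [this]
    rw [lintegral_mul_const _ hwm, ← ofReal_integral_eq_lintegral_ofReal φ.integrable_normed
        (Eventually.of_forall fun t => φ.nonneg_normed t), φ.integral_normed, ENNReal.ofReal_one,
        one_mul]
  · exact (hwm.comp measurable_snd).aemeasurable.mul
      ((hf.comp_quasiMeasurePreserving (quasiMeasurePreserving_sub ν ν)).enorm.pow_const _)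

theorem ContDiffBump.convolutionExists_of_locallyIntegrable (φ : ContDiffBump (0 : G)) {f : G → E}
    (hf : LocallyIntegrable f ν) :
    ConvolutionExists (φ.normed ν) f (ContinuousLinearMap.lsmul ℝ ℝ) ν :=
  φ.hasCompactSupport_normed.convolutionExists_left _ φ.continuous_normed hf

variable [CompleteSpace E]

/-- Mollifications of an `L²` function converge to it in `L²`. -/
theorem ContDiffBump.tendsto_eLpNorm_normed_convolution_sub {φ : ℕ → ContDiffBump (0 : G)}
    (hφ : Tendsto (fun j => (φ j).rOut) atTop (𝓝 0)) {f : G → E} (hf : MemLp f 2 ν) :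
    Tendsto (fun j => eLpNorm (((φ j).normed ν ⋆[ContinuousLinearMap.lsmul ℝ ℝ, ν] f) - f) 2 ν)
      atTop (𝓝 0) := by
  rw [ENNReal.tendsto_nhds_zero]
  intro ε hε
  have hε3 : ε / 3 ≠ 0 := (ENNReal.div_pos hε.ne' (by simp)).ne'
  obtain ⟨g, hgc, hfg, hgcont, hg⟩ := hf.exists_hasCompactSupport_eLpNorm_sub_le (by simp) hε3
  have hgu : UniformContinuous g := hgc.uniformContinuous_of_continuous hgcont
  have hfl : LocallyIntegrable f ν := hf.locallyIntegrable one_le_two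
  have hgl : LocallyIntegrable g ν := hg.locallyIntegrable one_le_two
  set K := Metric.cthickening 1 (tsupport g) with hK
  have hKc : IsCompact K := hgc.isCompact.cthickening
  -- the continuous part
  have hmid : ∀ᶠ j in atTop,
      eLpNorm (((φ j).normed ν ⋆[ContinuousLinearMap.lsmul ℝ ℝ, ν] g) - g) 2 ν ≤ ε / 3 := by
    have hKfin : ν K ^ (1 / (2 : ℝ)) ≠ ∞ :=
      ENNReal.rpow_ne_top_of_nonneg (by positivity) hKc.measure_lt_top.ne
    obtain ⟨η, hη, hηε⟩ : ∃ η : ℝ, 0 < η ∧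
        ENNReal.ofReal η * ν K ^ (1 / (2 : ℝ)) ≤ ε / 3 := by
      have ht : Tendsto (fun η : ℝ => ENNReal.ofReal η * ν K ^ (1 / (2 : ℝ))) (𝓝[>] 0) (𝓝 0) := by
        have := ENNReal.Tendsto.mul_const (b := ν K ^ (1 / (2 : ℝ)))
          ((ENNReal.continuous_ofReal.tendsto 0).mono_left
            (nhdsWithin_le_nhds (s := Set.Ioi 0)))
          (Or.inr hKfin)
        simpa using this
      have h1 := (ENNReal.tendsto_nhds_zero.1 ht) (ε / 3) (pos_iff_ne_zero.2 hε3)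
      obtain ⟨η, h2, h3⟩ := (h1.and self_mem_nhdsWithin).exists
      exact ⟨η, h3, h2⟩
    obtain ⟨δ, hδ, hgδ⟩ := Metric.uniformContinuous_iff.1 hgu η hη
    filter_upwards [hφ.eventually_lt_const hδ, hφ.eventually_lt_const zero_lt_one] with j hj hj1
    have hpt : ∀ x, ‖((φ j).normed ν ⋆[ContinuousLinearMap.lsmul ℝ ℝ, ν] g) x - g x‖ ≤ η := by
      intro x
      rw [← dist_eq_norm]
      refine (φ j).dist_normed_convolution_le hgcont.aestronglyMeasurable fun y hy => ?_
      exact (hgδ ((Metric.mem_ball.1 hy).trans hj)).le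
    have hz : ∀ x ∉ K, ((φ j).normed ν ⋆[ContinuousLinearMap.lsmul ℝ ℝ, ν] g) x - g x = 0 := by
      intro x hx
      have hy : ∀ y ∈ Metric.ball x (φ j).rOut, g y = 0 := by
        intro y hy
        by_contra hne
        refine hx (Metric.mem_cthickening_of_dist_le x y 1 _ (subset_tsupport g hne) ?_)
        exact ((Metric.mem_ball'.1 hy).trans hj1).le
      have hx0 : g x = 0 := hy x (Metric.mem_ball_self (φ j).rOut_pos)
      rw [(φ j).normed_convolution_eq_right (fun y h => by rw [hy y h, hx0]), sub_self]
    have : ((φ j).normed ν ⋆[ContinuousLinearMap.lsmul ℝ ℝ, ν] g) - g =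
        K.indicator (((φ j).normed ν ⋆[ContinuousLinearMap.lsmul ℝ ℝ, ν] g) - g) := by
      ext x
      by_cases hx : x ∈ K
      · simp [hx]
      · simpa [hx] using hz x hx
    rw [this, eLpNorm_indicator_eq_eLpNorm_restrict hKc.isClosed.measurableSet]
    refine (eLpNorm_le_of_ae_bound (Eventually.of_forall hpt)).trans ?_
    rw [mul_comm]
    simpa using hηε
  filter_upwards [hmid] with j hj
  have hsplit : ((φ j).normed ν ⋆[ContinuousLinearMap.lsmul ℝ ℝ, ν] f) - f =
      ((φ j).normed ν ⋆[ContinuousLinearMap.lsmul ℝ ℝ, ν] (f - g)) +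
      (((φ j).normed ν ⋆[ContinuousLinearMap.lsmul ℝ ℝ, ν] g) - g) - (f - g) := by
    have h := ((φ j).convolutionExists_of_locallyIntegrable (hfl.sub hgl)).distrib_add
      ((φ j).convolutionExists_of_locallyIntegrable hgl)
    rw [sub_add_cancel] at h
    rw [h]
    abel
  have hcm : ∀ {h : G → E}, LocallyIntegrable h ν → AEStronglyMeasurable
      ((φ j).normed ν ⋆[ContinuousLinearMap.lsmul ℝ ℝ, ν] h) ν := fun hh =>
    ((φ j).hasCompactSupport_normed.continuous_convolution_left _
      (φ j).continuous_normed hh).aestronglyMeasurable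
  rw [hsplit]
  have hA := (eLpNorm_sub_le (((hcm (hfl.sub hgl)).add
    ((hcm hgl).sub hg.1))) (hf.1.sub hg.1) (one_le_two : (1 : ℝ≥0∞) ≤ 2))
  have hB := (eLpNorm_add_le (hcm (hfl.sub hgl)) ((hcm hgl).sub hg.1)
    (one_le_two : (1 : ℝ≥0∞) ≤ 2))
  calc _ ≤ _ := hA
    _ ≤ (ε / 3 + ε / 3) + ε / 3 := by
      refine add_le_add (hB.trans (add_le_add ?_ hj)) hfg
      exact ((φ j).eLpNorm_normed_convolution_le (hf.1.sub hg.1)).trans hfg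
    _ = ε := ENNReal.add_thirds ε

end Mollification

section Limits

open Filter Topology

variable {α V F G : Type*} [MeasurableSpace α] {ν : Measure α}
  [NormedAddCommGroup V] [NormedSpace ℝ V]
  [NormedAddCommGroup F] [NormedSpace ℝ F] [NormedAddCommGroup G] [NormedSpace ℝ G]

theorem eLpNorm_clm_apply₂_le {b : α → F →L[ℝ] G →L[ℝ] ℝ} {C : NNReal} (hbC : ∀ᵐ x ∂ν, ‖b x‖ ≤ C)
    {q : α → F} {r : α → G} (hq : AEStronglyMeasurable q ν) (hr : AEStronglyMeasurable r ν) :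
    eLpNorm (fun x => b x (q x) (r x)) 1 ν ≤ C * eLpNorm q 2 ν * eLpNorm r 2 ν := by
  have h := eLpNorm_le_eLpNorm_mul_eLpNorm'_of_norm (μ := ν) (p := 2) (q := 2) (r := 1)
    hq.norm hr.norm (fun s t => s * t) 1 (by simp)
  rw [eLpNorm_norm, eLpNorm_norm, ENNReal.coe_one, one_mul] at h
  rw [mul_assoc]
  refine le_trans ?_ (mul_le_mul_right h _)
  refine eLpNorm_le_nnreal_smul_eLpNorm_of_ae_le_mul ?_ 1
  filter_upwards [hbC] with x hx
  rw [← NNReal.coe_le_coe, NNReal.coe_mul, coe_nnnorm, coe_nnnorm,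
    Real.norm_of_nonneg (mul_nonneg (norm_nonneg (q x)) (norm_nonneg (r x))), ← mul_assoc]
  exact ((b x).le_opNorm₂ (q x) (r x)).trans (by gcongr)

theorem integrable_clm_apply₂ {b : α → F →L[ℝ] G →L[ℝ] ℝ} {C : NNReal}
    (hbm : AEStronglyMeasurable b ν) (hbC : ∀ᵐ x ∂ν, ‖b x‖ ≤ C)
    {q : α → F} {r : α → G} (hq : MemLp q 2 ν) (hr : MemLp r 2 ν) :
    Integrable (fun x => b x (q x) (r x)) ν := by
  refine memLp_one_iff_integrable.1 ⟨?_, ?_⟩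
  · exact isBoundedBilinearMap_apply.continuous.comp_aestronglyMeasurable
      ((isBoundedBilinearMap_apply.continuous.comp_aestronglyMeasurable
        (hbm.prodMk hq.1)).prodMk hr.1)
  · exact (eLpNorm_clm_apply₂_le hbC hq.1 hr.1).trans_lt
      (ENNReal.mul_lt_top (ENNReal.mul_lt_top ENNReal.coe_lt_top hq.2) hr.2)

theorem abs_integral_clm_apply₂_le {b : α → F →L[ℝ] G →L[ℝ] ℝ} {C : NNReal}
    (hbC : ∀ᵐ x ∂ν, ‖b x‖ ≤ C)
    {q : α → F} {r : α → G} (hq : MemLp q 2 ν) (hr : MemLp r 2 ν) :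
    |∫ x, b x (q x) (r x) ∂ν| ≤ C * (eLpNorm q 2 ν).toReal * (eLpNorm r 2 ν).toReal := by
  have h := (enorm_integral_le_lintegral_enorm fun x => b x (q x) (r x)).trans
    ((eLpNorm_one_eq_lintegral_enorm (μ := ν)).symm.le.trans (eLpNorm_clm_apply₂_le hbC hq.1 hr.1))
  have h2 := ENNReal.toReal_mono (ENNReal.mul_ne_top (ENNReal.mul_ne_top ENNReal.coe_ne_top
    hq.2.ne) hr.2.ne) h
  simpa [ENNReal.toReal_mul] using h2

/-- Passage to the limit in trilinear expressions, with one factor converging boundedly almost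
everywhere and two factors converging in `L²`. -/
theorem tendsto_integral_clm_apply₂ {b : ℕ → α → F →L[ℝ] G →L[ℝ] ℝ} {b' : α → F →L[ℝ] G →L[ℝ] ℝ}
    {C : NNReal} (hbm : ∀ j, AEStronglyMeasurable (b j) ν) (hbC : ∀ j, ∀ᵐ x ∂ν, ‖b j x‖ ≤ C)
    (hb : ∀ᵐ x ∂ν, Tendsto (fun j => b j x) atTop (𝓝 (b' x)))
    {q : ℕ → α → F} {q' : α → F} {r : ℕ → α → G} {r' : α → G}
    (hqm : ∀ j, MemLp (q j) 2 ν) (hqm' : MemLp q' 2 ν)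
    (hrm : ∀ j, MemLp (r j) 2 ν) (hrm' : MemLp r' 2 ν)
    (hq : Tendsto (fun j => eLpNorm (q j - q') 2 ν) atTop (𝓝 0))
    (hr : Tendsto (fun j => eLpNorm (r j - r') 2 ν) atTop (𝓝 0)) :
    Tendsto (fun j => ∫ x, b j x (q j x) (r j x) ∂ν) atTop (𝓝 (∫ x, b' x (q' x) (r' x) ∂ν)) := by
  have hqr : Tendsto (fun j => (eLpNorm (q j - q') 2 ν).toReal) atTop (𝓝 0) := by
    simpa [Function.comp_def] using (ENNReal.tendsto_toReal ENNReal.zero_ne_top).comp hq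
  have hrr : Tendsto (fun j => (eLpNorm (r j - r') 2 ν).toReal) atTop (𝓝 0) := by
    simpa [Function.comp_def] using (ENNReal.tendsto_toReal ENNReal.zero_ne_top).comp hr
  have hsplit : ∀ j, ∫ x, b j x (q j x) (r j x) ∂ν = (∫ x, b j x ((q j - q') x) ((r j - r') x) ∂ν
      + ∫ x, b j x ((q j - q') x) (r' x) ∂ν) + (∫ x, b j x (q' x) ((r j - r') x) ∂ν
      + ∫ x, b j x (q' x) (r' x) ∂ν) := by
    intro j
    have i1 := integrable_clm_apply₂ (hbm j) (hbC j) ((hqm j).sub hqm') ((hrm j).sub hrm')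
    have i2 := integrable_clm_apply₂ (hbm j) (hbC j) ((hqm j).sub hqm') hrm'
    have i3 := integrable_clm_apply₂ (hbm j) (hbC j) hqm' ((hrm j).sub hrm')
    have i4 := integrable_clm_apply₂ (hbm j) (hbC j) hqm' hrm'
    rw [← integral_add i1 i2, ← integral_add i3 i4,
      ← integral_add (by exact i1.add i2) (by exact i3.add i4)]
    refine integral_congr_ae (Eventually.of_forall fun x => ?_)
    simp only [Pi.sub_apply, map_sub, sub_apply]
    ring
  have l1 : Tendsto (fun j => ∫ x, b j x ((q j - q') x) ((r j - r') x) ∂ν) atTop (𝓝 0) := by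
    refine squeeze_zero_norm (fun j => abs_integral_clm_apply₂_le (hbC j)
      ((hqm j).sub hqm') ((hrm j).sub hrm')) ?_
    simpa using (hqr.const_mul (C : ℝ)).mul hrr
  have l2 : Tendsto (fun j => ∫ x, b j x ((q j - q') x) (r' x) ∂ν) atTop (𝓝 0) := by
    refine squeeze_zero_norm (fun j => abs_integral_clm_apply₂_le (hbC j)
      ((hqm j).sub hqm') hrm') ?_
    simpa using (hqr.const_mul (C : ℝ)).mul_const (eLpNorm r' 2 ν).toReal
  have l3 : Tendsto (fun j => ∫ x, b j x (q' x) ((r j - r') x) ∂ν) atTop (𝓝 0) := by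
    refine squeeze_zero_norm (fun j => abs_integral_clm_apply₂_le (hbC j) hqm'
      ((hrm j).sub hrm')) ?_
    simpa using hrr.const_mul ((C : ℝ) * (eLpNorm q' 2 ν).toReal)
  have l4 : Tendsto (fun j => ∫ x, b j x (q' x) (r' x) ∂ν) atTop
      (𝓝 (∫ x, b' x (q' x) (r' x) ∂ν)) := by
    refine tendsto_integral_of_dominated_convergence (fun x => C * (‖q' x‖ * ‖r' x‖))
      (fun j => (integrable_clm_apply₂ (hbm j) (hbC j) hqm' hrm').1)
      ((hqm'.norm.integrable_mul hrm'.norm).const_mul _) (fun j => ?_) ?_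
    · filter_upwards [hbC j] with x hx
      rw [← mul_assoc]
      exact ((b j x).le_opNorm₂ _ _).trans (by gcongr)
    · filter_upwards [hb] with x hx
      exact ((ContinuousLinearMap.apply ℝ ℝ (r' x)).continuous.tendsto _).comp
        (((ContinuousLinearMap.apply ℝ (G →L[ℝ] ℝ) (q' x)).continuous.tendsto _).comp hx)
  simp_rw [hsplit]
  simpa using (l1.add l2).add (l3.add l4)

end Limits

section Pullback

open Filter Topology
open scoped Convolution ContDiff

theorem hasFDerivAt_oneForm_comp {β : Space3 → Space3 →L[ℝ] ℝ} (hβ : ContDiff ℝ ∞ β)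
    {u : Plane → Space3} (hu : ContDiff ℝ ∞ u) (e : Plane) (X : Plane) :
    HasFDerivAt (fun X => β (u X) (fderiv ℝ u X e))
      ((((fderiv ℝ β (u X)).comp (fderiv ℝ u X)).flip (fderiv ℝ u X e)) +
        (β (u X)).comp ((fderiv ℝ (fderiv ℝ u) X).flip e)) X := by
  have h1 : HasFDerivAt (fun X => β (u X)) ((fderiv ℝ β (u X)).comp (fderiv ℝ u X)) X :=
    ((hβ.differentiable (by simp)) (u X)).hasFDerivAt.comp X
      ((hu.differentiable (by simp)) X).hasFDerivAt
  have h2 : HasFDerivAt (fun X => fderiv ℝ u X e) ((fderiv ℝ (fderiv ℝ u) X).flip e) X := by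
    have h3 : HasFDerivAt (fderiv ℝ u) (fderiv ℝ (fderiv ℝ u) X) X :=
      ((hu.fderiv_right (m := ∞) (by simp)).differentiable (by simp) X).hasFDerivAt
    exact h3.clm_apply (hasFDerivAt_const e X) |>.congr_fderiv (by ext; simp)
  exact (h1.clm_apply h2).congr_fderiv (by ext; simp [add_comm])

/-- Stokes' theorem for the pull-back of a one-form under a smooth map, tested with a
compactly supported function. -/
theorem integral_oneForm_comp_smooth {β : Space3 → Space3 →L[ℝ] ℝ} (hβ : ContDiff ℝ ∞ β)
    {u : Plane → Space3} (hu : ContDiff ℝ ∞ u) {ζ : Plane → ℝ} (hζ : ContDiff ℝ ∞ ζ)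
    (hζc : HasCompactSupport ζ) (e₀ e₁ : Plane) :
    ∫ X, (fderiv ℝ ζ X e₀ * β (u X) (fderiv ℝ u X e₁)
        - fderiv ℝ ζ X e₁ * β (u X) (fderiv ℝ u X e₀)) =
      - ∫ X, ζ X * (fderiv ℝ β (u X) (fderiv ℝ u X e₀) (fderiv ℝ u X e₁)
        - fderiv ℝ β (u X) (fderiv ℝ u X e₁) (fderiv ℝ u X e₀)) := by
  set B : Plane → Plane → ℝ := fun e X => β (u X) (fderiv ℝ u X e) with hB
  have hBd : ∀ e, ContDiff ℝ ∞ (B e) := fun e =>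
    (hβ.comp hu).clm_apply ((hu.fderiv_right (m := ∞) (by simp)).clm_apply contDiff_const)
  have hζd : ∀ e, Continuous fun X => fderiv ℝ ζ X e := fun e =>
    ((hζ.fderiv_right (m := ∞) (by simp)).clm_apply contDiff_const).continuous
  have hζdc : ∀ e, HasCompactSupport fun X => fderiv ℝ ζ X e := fun e =>
    hζc.fderiv_apply ℝ e
  have hBdd : ∀ e e', Continuous fun X => fderiv ℝ (B e) X e' := fun e e' =>
    (((hBd e).fderiv_right (m := ∞) (by simp)).clm_apply contDiff_const).continuous
  have i1 : ∀ e e', Integrable fun X => fderiv ℝ ζ X e * B e' X := fun e e' =>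
    ((hζd e).mul (hBd e').continuous).integrable_of_hasCompactSupport (hζdc e).mul_right
  have i2 : ∀ e e', Integrable fun X => ζ X * fderiv ℝ (B e) X e' := fun e e' =>
    (hζ.continuous.mul (hBdd e e')).integrable_of_hasCompactSupport hζc.mul_right
  have i3 : ∀ e, Integrable fun X => ζ X * B e X := fun e =>
    (hζ.continuous.mul (hBd e).continuous).integrable_of_hasCompactSupport hζc.mul_right
  have key : ∀ e e', ∫ X, fderiv ℝ ζ X e * B e' X = - ∫ X, ζ X * fderiv ℝ (B e') X e := by
    intro e e'
    rw [integral_mul_fderiv_eq_neg_fderiv_mul_of_integrable (i1 e e') (i2 e' e) (i3 e')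
      (fun x _ => hζ.differentiable (by simp) x) (fun x _ => (hBd e').differentiable (by simp) x),
      neg_neg]
  rw [integral_sub (i1 e₀ e₁) (i1 e₁ e₀), key, key, ← neg_sub', ← integral_sub (i2 _ _) (i2 _ _)]
  congr 1
  refine integral_congr_ae (Eventually.of_forall fun X => ?_)
  have hs : fderiv ℝ (fderiv ℝ u) X e₀ e₁ = fderiv ℝ (fderiv ℝ u) X e₁ e₀ :=
    (hu.contDiffAt.isSymmSndFDerivAt (by
      rw [minSmoothness_of_isRCLikeNormedField]
      exact WithTop.coe_le_coe.2 (le_top : (2 : ℕ∞) ≤ ⊤))) e₀ e₁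
  simp only [hB, (hasFDerivAt_oneForm_comp hβ hu _ X).fderiv]
  simp [hs]
  ring

theorem volume_closedDisc_lt_top : volume closedDisc < ⊤ := measure_closedBall_lt_top

instance : IsFiniteMeasure discMeasure :=
  ⟨by simpa [discMeasure] using volume_closedDisc_lt_top⟩

theorem measurableSet_closedDisc : MeasurableSet closedDisc := measurableSet_closedBall

theorem testFunction_eq_zero (ζ : 𝓓(openDisc, ℝ)) {X : Plane} (hX : X ∉ closedDisc) : ζ X = 0 := by
  refine image_eq_zero_of_notMem_tsupport fun h => hX ?_
  exact Metric.ball_subset_closedBall (ζ.tsupport_subset h)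

theorem partialDeriv_testFunction_eq_zero (ζ : 𝓓(openDisc, ℝ)) (i : Fin 2) {X : Plane}
    (hX : X ∉ tsupport ζ) : partialDeriv i ζ X = 0 := by
  have := image_eq_zero_of_notMem_tsupport (f := fderiv ℝ ζ)
    (fun h => hX (tsupport_fderiv_subset ℝ h))
  simp [partialDeriv, this]

/-- Mollification commutes with weak differentiation away from the boundary. -/
theorem IsW12SphereMap.fderiv_normed_convolution {n : Plane → Space3} {p : Fin 2 → Plane → Space3}
    (h : IsW12SphereMap n p) (φ : ContDiffBump (0 : Plane)) {X : Plane}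
    (hX : Metric.closedBall X φ.rOut ⊆ Metric.ball 0 1) (i : Fin 2) :
    fderiv ℝ (φ.normed volume ⋆[ContinuousLinearMap.lsmul ℝ ℝ] closedDisc.indicator n) X
        (EuclideanSpace.single i 1) =
      (φ.normed volume ⋆[ContinuousLinearMap.lsmul ℝ ℝ] closedDisc.indicator (p i)) X := by
  have hn : Integrable (closedDisc.indicator n) volume :=
    (integrable_indicator_iff measurableSet_closedDisc).2 (h.memLp.integrable one_le_two)
  set ψ : Plane → ℝ := fun z => φ.normed volume (X - z) with hψ
  have hψs : tsupport ψ ⊆ Metric.closedBall X φ.rOut := by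
    refine closure_minimal (fun z hz => ?_) Metric.isClosed_closedBall
    have : X - z ∈ Metric.ball (0 : Plane) φ.rOut := by
      rw [← φ.support_normed_eq (μ := volume)]; exact hz
    rw [mem_ball_zero_iff] at this
    rw [mem_closedBall_iff_norm']
    exact this.le
  let ζ : 𝓓(openDisc, ℝ) :=
    { toFun := ψ
      contDiff' := φ.contDiff_normed.comp (contDiff_const.sub contDiff_id)
      hasCompactSupport' := (isCompact_closedBall X φ.rOut).of_isClosed_subset
        (isClosed_tsupport _) hψs
      tsupport_subset' := hψs.trans hX }
  have hζ : ∀ z, ζ z = φ.normed volume (X - z) := fun _ => rfl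
  have hd : ∀ z, partialDeriv i ζ z = - fderiv ℝ (φ.normed volume) (X - z)
      (EuclideanSpace.single i 1) := by
    intro z
    have h1 : HasFDerivAt (φ.normed volume) (fderiv ℝ (φ.normed volume) (X - z)) (X - z) :=
      ((φ.contDiff_normed (n := 1)).differentiable (by simp) _).hasFDerivAt
    have h2 := h1.comp z ((hasFDerivAt_id z).const_sub X)
    have h3 : fderiv ℝ ζ z = _ := h2.fderiv
    rw [partialDeriv, h3]
    simp
  have hw := h.weak_deriv i ζ
  have hder := (φ.hasCompactSupport_normed (μ := volume)).hasFDerivAt_convolution_left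
    (ContinuousLinearMap.lsmul ℝ ℝ) (φ.contDiff_normed (n := 1)) hn.locallyIntegrable X
  rw [hder.fderiv]
  have hcov : ConvolutionExistsAt (fderiv ℝ (φ.normed volume)) (closedDisc.indicator n) X
      ((ContinuousLinearMap.lsmul ℝ ℝ).precompL Plane) volume :=
    ((φ.hasCompactSupport_normed.fderiv ℝ).convolutionExists_left _
      ((φ.contDiff_normed (n := 1)).continuous_fderiv (by simp)) hn.locallyIntegrable) X
  rw [convolution_eq_swap, convolution_eq_swap,
    ContinuousLinearMap.integral_apply hcov.integrable_swap]
  have e1 : ∫ z, (((ContinuousLinearMap.lsmul ℝ ℝ).precompL Plane)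
      (fderiv ℝ (φ.normed volume) (X - z)) (closedDisc.indicator n z) : Plane →L[ℝ] Space3)
        (EuclideanSpace.single i 1) = - ∫ z, partialDeriv i ζ z • n z ∂discMeasure := by
    rw [discMeasure, ← integral_indicator measurableSet_closedDisc, ← integral_neg]
    refine integral_congr_ae (Eventually.of_forall fun z => ?_)
    by_cases hz : z ∈ closedDisc <;> simp [hz, hd]
  have e2 : ∫ z, ContinuousLinearMap.lsmul ℝ ℝ (φ.normed volume (X - z))
      (closedDisc.indicator (p i) z) = ∫ z, ζ z • p i z ∂discMeasure := by
    rw [discMeasure, ← integral_indicator measurableSet_closedDisc]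
    refine integral_congr_ae (Eventually.of_forall fun z => ?_)
    by_cases hz : z ∈ closedDisc <;> simp [hz, hζ]
  rw [e1, e2, hw, neg_neg]

set_option maxSynthPendingDepth 3 in
theorem tendsto_integral_clm_apply₂_comp {F G : Type*} [NormedAddCommGroup F] [NormedSpace ℝ F]
    [NormedAddCommGroup G] [NormedSpace ℝ G] {b : Space3 → F →L[ℝ] G →L[ℝ] ℝ} (hb : Continuous b)
    {w : Plane → ℝ} (hw : Continuous w) {M : ℝ} (hM : ∀ X, |w X| ≤ M)
    {u : ℕ → Plane → Space3} {u' : Plane → Space3} (hu : ∀ j, Continuous (u j))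
    (hu1 : ∀ j X, ‖u j X‖ ≤ 1) (hlim : ∀ᵐ X, Tendsto (fun j => u j X) atTop (𝓝 (u' X)))
    {q : ℕ → Plane → F} {q' : Plane → F} {r : ℕ → Plane → G} {r' : Plane → G}
    (hqm : ∀ j, MemLp (q j) 2 volume) (hqm' : MemLp q' 2 volume)
    (hrm : ∀ j, MemLp (r j) 2 volume) (hrm' : MemLp r' 2 volume)
    (hq : Tendsto (fun j => eLpNorm (q j - q') 2 volume) atTop (𝓝 0))
    (hr : Tendsto (fun j => eLpNorm (r j - r') 2 volume) atTop (𝓝 0)) :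
    Tendsto (fun j => ∫ X, w X * b (u j X) (q j X) (r j X)) atTop
      (𝓝 (∫ X, w X * b (u' X) (q' X) (r' X))) := by
  obtain ⟨C, hC⟩ := IsCompact.exists_bound_of_continuousOn (E := F →L[ℝ] G →L[ℝ] ℝ)
    (isCompact_closedBall (0 : Space3) 1) hb.continuousOn
  have hM0 : 0 ≤ M := (abs_nonneg _).trans (hM 0)
  have hC0 : 0 ≤ C := (norm_nonneg _).trans (hC 0 (by simp))
  have := tendsto_integral_clm_apply₂ (ν := (volume : Measure Plane))
    (b := fun j X => w X • b (u j X)) (b' := fun X => w X • b (u' X))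
    (C := ⟨M * C, mul_nonneg hM0 hC0⟩)
    (fun j => (hw.smul (hb.comp (hu j))).aestronglyMeasurable)
    (fun j => Eventually.of_forall fun X => by
      rw [norm_smul]
      exact mul_le_mul (hM X) (hC _ (by simpa using hu1 j X)) (norm_nonneg _) hM0)
    (by
      filter_upwards [hlim] with X hX
      exact ((hb.tendsto _).comp hX).const_smul _)
    hqm hqm' hrm hrm' hq hr
  simpa using this

set_option maxSynthPendingDepth 3 in
theorem integrable_clm_apply₂_comp {F G : Type*} [NormedAddCommGroup F] [NormedSpace ℝ F]
    [NormedAddCommGroup G] [NormedSpace ℝ G] {b : Space3 → F →L[ℝ] G →L[ℝ] ℝ} (hb : Continuous b)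
    {w : Plane → ℝ} (hw : Continuous w) {M : ℝ} (hM : ∀ X, |w X| ≤ M) {ν : Measure Plane}
    {u : Plane → Space3} (hu : AEStronglyMeasurable u ν) (hu1 : ∀ᵐ X ∂ν, ‖u X‖ ≤ 1)
    {q : Plane → F} {r : Plane → G} (hqm : MemLp q 2 ν) (hrm : MemLp r 2 ν) :
    Integrable (fun X => w X * b (u X) (q X) (r X)) ν := by
  obtain ⟨C, hC⟩ := IsCompact.exists_bound_of_continuousOn (E := F →L[ℝ] G →L[ℝ] ℝ)
    (isCompact_closedBall (0 : Space3) 1) hb.continuousOn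
  have hM0 : 0 ≤ M := (abs_nonneg _).trans (hM 0)
  have hC0 : 0 ≤ C := (norm_nonneg _).trans (hC 0 (by simp))
  have := integrable_clm_apply₂ (ν := ν) (b := fun X => w X • b (u X))
    (C := ⟨M * C, mul_nonneg hM0 hC0⟩)
    (hw.aestronglyMeasurable.smul (hb.comp_aestronglyMeasurable hu))
    (by
      filter_upwards [hu1] with X hX
      rw [norm_smul]
      exact mul_le_mul (hM X) (hC _ (by simpa using hX)) (norm_nonneg _) hM0)
    hqm hrm
  simpa using this

theorem ContDiffBump.norm_normed_convolution_le_one (φ : ContDiffBump (0 : Plane))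
    {f : Plane → Space3} (hf : ∀ᵐ X, ‖f X‖ ≤ 1) (X : Plane) :
    ‖(φ.normed volume ⋆[ContinuousLinearMap.lsmul ℝ ℝ] f) X‖ ≤ 1 := by
  rw [convolution_lsmul_swap, ← φ.integral_normed (μ := volume),
    ← integral_sub_left_eq_self (φ.normed volume) volume X]
  refine norm_integral_le_of_norm_le (φ.integrable_normed.comp_sub_left X) ?_
  filter_upwards [hf] with z hz
  rw [norm_smul, Real.norm_of_nonneg (φ.nonneg_normed _)]
  exact mul_le_of_le_one_right (φ.nonneg_normed _) hz

/-- Stokes' theorem for the pull-back of a smooth one-form under a Sobolev map into the sphere. -/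
theorem IsW12SphereMap.integral_oneForm_comp {n : Plane → Space3} {p : Fin 2 → Plane → Space3}
    (h : IsW12SphereMap n p) {β : Space3 → Space3 →L[ℝ] ℝ} (hβ : ContDiff ℝ ∞ β)
    (ζ : 𝓓(openDisc, ℝ)) :
    ∫ X, (partialDeriv 0 ζ X * β (n X) (p 1 X) - partialDeriv 1 ζ X * β (n X) (p 0 X))
        ∂discMeasure =
      - ∫ X, ζ X * (fderiv ℝ β (n X) (p 0 X) (p 1 X) - fderiv ℝ β (n X) (p 1 X) (p 0 X))
        ∂discMeasure := by
  set n' := closedDisc.indicator n with hn'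
  set p' : Fin 2 → Plane → Space3 := fun i => closedDisc.indicator (p i) with hp'
  have htrans : ∀ F F' : Plane → ℝ, (∀ X ∉ closedDisc, F X = 0) →
      (∀ X ∈ closedDisc, F X = F' X) → ∫ X, F X = ∫ X, F' X ∂discMeasure := by
    intro F F' h0 h1
    rw [← setIntegral_eq_integral_of_forall_compl_eq_zero h0, discMeasure]
    exact setIntegral_congr_fun measurableSet_closedDisc h1
  have hζd : ∀ i, ∀ X ∉ closedDisc, partialDeriv i ζ X = 0 := fun i X hX =>
    partialDeriv_testFunction_eq_zero ζ i fun hX' =>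
      hX (Metric.ball_subset_closedBall (ζ.tsupport_subset hX'))
  rw [← htrans (fun X => partialDeriv 0 ζ X * β (n' X) (p' 1 X)
      - partialDeriv 1 ζ X * β (n' X) (p' 0 X)) _
      (fun X hX => by simp [hζd _ X hX]) (fun X hX => by simp [hn', hp', hX]),
    ← htrans (fun X => ζ X * (fderiv ℝ β (n' X) (p' 0 X) (p' 1 X)
      - fderiv ℝ β (n' X) (p' 1 X) (p' 0 X))) _
      (fun X hX => by simp [testFunction_eq_zero ζ hX]) (fun X hX => by simp [hn', hp', hX])]
  have hn'i : Integrable n' volume :=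
    (integrable_indicator_iff measurableSet_closedDisc).2 (h.memLp.integrable one_le_two)
  have hp'm : ∀ i, MemLp (p' i) 2 volume := fun i =>
    (memLp_indicator_iff_restrict measurableSet_closedDisc).2 (h.memLp_deriv i)
  have hn'1 : ∀ᵐ X, ‖n' X‖ ≤ 1 := by
    have h1 := (ae_restrict_iff' measurableSet_closedDisc).1 h.norm_eq_one
    filter_upwards [h1] with X hX
    by_cases hXd : X ∈ closedDisc
    · simp [hn', hXd, hX hXd]
    · simp [hn', hXd]
  let φ : ℕ → ContDiffBump (0 : Plane) := fun j =>
    ⟨(1 / 2) * (1 / ((j : ℝ) + 1)), 1 / ((j : ℝ) + 1), by positivity, by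
      have : 0 < 1 / ((j : ℝ) + 1) := by positivity
      linarith⟩
  have hφ : Tendsto (fun j => (φ j).rOut) atTop (𝓝 0) := tendsto_one_div_add_atTop_nhds_zero_nat
  set u : ℕ → Plane → Space3 := fun j =>
    (φ j).normed volume ⋆[ContinuousLinearMap.lsmul ℝ ℝ] n' with hu
  set q : Fin 2 → ℕ → Plane → Space3 := fun i j =>
    (φ j).normed volume ⋆[ContinuousLinearMap.lsmul ℝ ℝ] p' i with hq
  have hus : ∀ j, ContDiff ℝ ∞ (u j) := fun j =>
    (φ j).hasCompactSupport_normed.contDiff_convolution_left _ (φ j).contDiff_normed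
      hn'i.locallyIntegrable
  have hu1 : ∀ j X, ‖u j X‖ ≤ 1 := fun j X => (φ j).norm_normed_convolution_le_one hn'1 X
  have hulim : ∀ᵐ X, Tendsto (fun j => u j X) atTop (𝓝 (n' X)) :=
    ContDiffBump.ae_convolution_tendsto_right_of_locallyIntegrable (K := 2) hφ
      (Eventually.of_forall fun j => le_of_eq (by simp [φ])) hn'i.locallyIntegrable
  have hqc : ∀ i j, Continuous (q i j) := fun i j =>
    (φ j).hasCompactSupport_normed.continuous_convolution_left _ (φ j).continuous_normed
      ((hp'm i).locallyIntegrable one_le_two)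
  have hqm : ∀ i j, MemLp (q i j) 2 volume := fun i j =>
    ⟨(hqc i j).aestronglyMeasurable,
      ((φ j).eLpNorm_normed_convolution_le (hp'm i).1).trans_lt (hp'm i).2⟩
  have hqlim : ∀ i, Tendsto (fun j => eLpNorm (q i j - p' i) 2 volume) atTop (𝓝 0) := fun i =>
    ContDiffBump.tendsto_eLpNorm_normed_convolution_sub hφ (hp'm i)
  have hζc : Continuous ζ := ζ.continuous
  have hζ2 : ContDiff ℝ ∞ ζ := ζ.contDiff
  have hdc : ∀ i, Continuous (partialDeriv i ζ) := fun i =>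
    ((hζ2.fderiv_right (m := ∞) (by simp)).clm_apply contDiff_const).continuous
  have hds : ∀ i, HasCompactSupport (partialDeriv i ζ) := fun i =>
    ζ.hasCompactSupport.fderiv_apply ℝ _
  have hdm : ∀ i, MemLp (partialDeriv i ζ) 2 volume := fun i =>
    (hdc i).memLp_of_hasCompactSupport (hds i)
  obtain ⟨M, hM⟩ := hζc.bounded_above_of_compact_support ζ.hasCompactSupport
  -- the identity for mollified maps
  obtain ⟨δ, hδ, hδs⟩ := ζ.hasCompactSupport.isCompact.exists_cthickening_subset_open
    Metric.isOpen_ball ζ.tsupport_subset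
  let b : Space3 → Space3 →L[ℝ] ℝ →L[ℝ] ℝ := fun x =>
    (β x).smulRight (ContinuousLinearMap.id ℝ ℝ)
  have hb : Continuous b := by
    have := ((ContinuousLinearMap.smulRightL ℝ Space3 (ℝ →L[ℝ] ℝ)).flip
      (ContinuousLinearMap.id ℝ ℝ)).continuous.comp hβ.continuous
    exact this
  have hβ' : Continuous (fderiv ℝ β) := hβ.continuous_fderiv (by simp)
  have L1 : ∀ i k, Tendsto (fun j => ∫ X, 1 * b (u j X) (q i j X) (partialDeriv k ζ X)) atTop
      (𝓝 (∫ X, 1 * b (n' X) (p' i X) (partialDeriv k ζ X))) := fun i k =>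
    tendsto_integral_clm_apply₂_comp hb (w := fun _ => 1) continuous_const (M := 1) (by simp)
      (fun j => (hus j).continuous) hu1 hulim (hqm i) (hp'm i) (r := fun _ => partialDeriv k ζ)
      (fun _ => hdm k) (hdm k) (hqlim i) (by simp)
  have L2 : ∀ i k, Tendsto (fun j => ∫ X, ζ X * fderiv ℝ β (u j X) (q i j X) (q k j X)) atTop
      (𝓝 (∫ X, ζ X * fderiv ℝ β (n' X) (p' i X) (p' k X))) := fun i k =>
    tendsto_integral_clm_apply₂_comp hβ' hζc (M := M) (by simpa using hM)
      (fun j => (hus j).continuous) hu1 hulim (hqm i) (hp'm i)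
      (hqm k) (hp'm k) (hqlim i) (hqlim k)
  have I1 : ∀ {v y : Plane → Space3}, AEStronglyMeasurable v → (∀ᵐ X, ‖v X‖ ≤ 1) →
      MemLp y 2 volume → ∀ k, Integrable fun X => 1 * b (v X) (y X) (partialDeriv k ζ X) :=
    fun hv hv1 hy k => integrable_clm_apply₂_comp hb (w := fun _ => 1) continuous_const (M := 1)
      (by simp) hv hv1 hy (hdm k)
  have I2 : ∀ {v y z : Plane → Space3}, AEStronglyMeasurable v → (∀ᵐ X, ‖v X‖ ≤ 1) →
      MemLp y 2 volume → MemLp z 2 volume →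
      Integrable fun X => ζ X * fderiv ℝ β (v X) (y X) (z X) :=
    fun hv hv1 hy hz => integrable_clm_apply₂_comp hβ' hζc (by simpa using hM) hv hv1 hy hz
  have J1 : ∀ {v : Plane → Space3} {y : Fin 2 → Plane → Space3}, AEStronglyMeasurable v →
      (∀ᵐ X, ‖v X‖ ≤ 1) → (∀ i, MemLp (y i) 2 volume) →
      ∫ X, (partialDeriv 0 ζ X * β (v X) (y 1 X) - partialDeriv 1 ζ X * β (v X) (y 0 X)) =
        (∫ X, 1 * b (v X) (y 1 X) (partialDeriv 0 ζ X))
          - ∫ X, 1 * b (v X) (y 0 X) (partialDeriv 1 ζ X) := by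
    intro v y hv hv1 hy
    rw [← integral_sub (I1 hv hv1 (hy 1) 0) (I1 hv hv1 (hy 0) 1)]
    refine integral_congr_ae (Eventually.of_forall fun X => ?_)
    simp only [b, ContinuousLinearMap.smulRight_apply, smul_apply,
      ContinuousLinearMap.id_apply, smul_eq_mul]
    ring
  have J2 : ∀ {v : Plane → Space3} {y : Fin 2 → Plane → Space3}, AEStronglyMeasurable v →
      (∀ᵐ X, ‖v X‖ ≤ 1) → (∀ i, MemLp (y i) 2 volume) →
      ∫ X, ζ X * (fderiv ℝ β (v X) (y 0 X) (y 1 X) - fderiv ℝ β (v X) (y 1 X) (y 0 X)) =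
        (∫ X, ζ X * fderiv ℝ β (v X) (y 0 X) (y 1 X))
          - ∫ X, ζ X * fderiv ℝ β (v X) (y 1 X) (y 0 X) := by
    intro v y hv hv1 hy
    rw [← integral_sub (I2 hv hv1 (hy 0) (hy 1)) (I2 hv hv1 (hy 1) (hy 0))]
    simp only [mul_sub]
  rw [J1 hn'i.1 hn'1 hp'm, J2 hn'i.1 hn'1 hp'm]
  refine tendsto_nhds_unique ((L1 1 0).sub (L1 0 1)) (((L2 0 1).sub (L2 1 0)).neg.congr' ?_)
  filter_upwards [hφ.eventually_lt_const hδ] with j hj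
  have hder : ∀ X ∈ tsupport ζ, ∀ i, fderiv ℝ (u j) X (EuclideanSpace.single i 1) = q i j X :=
    fun X hX i => h.fderiv_normed_convolution (φ j) (fun z hz => hδs
      (Metric.mem_cthickening_of_dist_le z X δ _ hX ((Metric.mem_closedBall.1 hz).trans hj.le))) i
  rw [← J1 (y := fun i => q i j) (hus j).continuous.aestronglyMeasurable
      (Eventually.of_forall (hu1 j)) (fun i => hqm i j),
    ← J2 (y := fun i => q i j) (hus j).continuous.aestronglyMeasurable
      (Eventually.of_forall (hu1 j)) (fun i => hqm i j)]
  have hcl := integral_oneForm_comp_smooth hβ (hus j) hζ2 ζ.hasCompactSupport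
    (EuclideanSpace.single 0 1) (EuclideanSpace.single 1 1)
  refine Eq.trans ?_ (hcl.symm.trans ?_)
  · congr 1
    refine integral_congr_ae (Eventually.of_forall fun X => ?_)
    by_cases hX : X ∈ tsupport ζ
    · simp only [hder X hX]
    · simp [image_eq_zero_of_notMem_tsupport hX]
  · refine integral_congr_ae (Eventually.of_forall fun X => ?_)
    by_cases hX : X ∈ tsupport ζ
    · simp only [hder X hX, partialDeriv]
    · have h0 := partialDeriv_testFunction_eq_zero ζ 0 hX
      have h1 := partialDeriv_testFunction_eq_zero ζ 1 hX
      simp only [partialDeriv] at h0 h1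
      simp [partialDeriv, h0, h1]

end Pullback

section Kernel

open scoped ContDiff RealInnerProductSpace

/-- The triple product `a · (b × c)`, as a bilinear form in `b` and `c`. -/
noncomputable def tripleForm (a : Space3) : Space3 →L[ℝ] Space3 →L[ℝ] ℝ :=
  LinearMap.toContinuousBilinearMap
    (LinearMap.mk₂ ℝ (fun b c : Space3 => a.ofLp ⬝ᵥ (b.ofLp ⨯₃ c.ofLp))
      (fun b b' c => by simp [cross_apply]; ring)
      (fun r b c => by simp [cross_apply]; ring)
      (fun b c c' => by simp [cross_apply]; ring)
      (fun r b c => by simp [cross_apply]; ring))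

theorem tripleForm_apply (a b c : Space3) :
    tripleForm a b c = a.ofLp ⬝ᵥ (b.ofLp ⨯₃ c.ofLp) := rfl

theorem tripleForm_eq (a b c : Space3) :
    tripleForm a b c = a 0 * (b 1 * c 2 - b 2 * c 1) + a 1 * (b 2 * c 0 - b 0 * c 2)
      + a 2 * (b 0 * c 1 - b 1 * c 0) := by
  simp [tripleForm_apply, cross_apply, dotProduct, Fin.sum_univ_three]

theorem inner_space3_eq (a b : Space3) : ⟪a, b⟫ = a 0 * b 0 + a 1 * b 1 + a 2 * b 2 := by
  simp [PiLp.inner_apply, Fin.sum_univ_three, mul_comm]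

theorem tripleForm_swap (a b c : Space3) : tripleForm a c b = - tripleForm a b c := by
  simp only [tripleForm_eq]; ring

theorem abs_tripleForm_le (a b c : Space3) : |tripleForm a b c| ≤ ‖a‖ * ‖b‖ * ‖c‖ := by
  refine abs_le_of_sq_le_sq ?_ (by positivity)
  have h : ∀ v : Space3, ‖v‖ ^ 2 = v 0 ^ 2 + v 1 ^ 2 + v 2 ^ 2 := fun v => by
    rw [EuclideanSpace.norm_sq_eq, Fin.sum_univ_three]; simp
  have h1 : tripleForm a b c ^ 2 ≤ ‖a‖ ^ 2 * ((b 1 * c 2 - b 2 * c 1) ^ 2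
      + (b 2 * c 0 - b 0 * c 2) ^ 2 + (b 0 * c 1 - b 1 * c 0) ^ 2) := by
    rw [tripleForm_eq, h]
    generalize b 1 * c 2 - b 2 * c 1 = p
    generalize b 2 * c 0 - b 0 * c 2 = q
    generalize b 0 * c 1 - b 1 * c 0 = r
    nlinarith [sq_nonneg (a 0 * q - a 1 * p), sq_nonneg (a 0 * r - a 2 * p),
      sq_nonneg (a 1 * r - a 2 * q)]
  have h2 : (b 1 * c 2 - b 2 * c 1) ^ 2 + (b 2 * c 0 - b 0 * c 2) ^ 2
      + (b 0 * c 1 - b 1 * c 0) ^ 2 ≤ ‖b‖ ^ 2 * ‖c‖ ^ 2 := by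
    rw [h, h]
    nlinarith [sq_nonneg (b 0 * c 0 + b 1 * c 1 + b 2 * c 2)]
  calc _ ≤ _ := h1
    _ ≤ ‖a‖ ^ 2 * (‖b‖ ^ 2 * ‖c‖ ^ 2) := by gcongr
    _ = _ := by ring

/-- `y · (x × v)` is small when `x` is near `y`. -/
theorem abs_tripleForm_le_norm_sub (y x v : Space3) :
    |tripleForm y x v| ≤ ‖y‖ * ‖x - y‖ * ‖v‖ := by
  have : tripleForm y x v = tripleForm y (x - y) v := by
    simp only [tripleForm_eq, PiLp.sub_apply]; ring
  rw [this]
  exact abs_tripleForm_le _ _ _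

theorem inner_mul_tripleForm_sub (a x y v w : Space3) :
    ⟪a, v⟫ * tripleForm y x w - ⟪a, w⟫ * tripleForm y x v =
      tripleForm y v w * ⟪x, a⟫ - ⟪y, a⟫ * tripleForm x v w := by
  simp only [tripleForm_eq, inner_space3_eq]; ring

/-- The regularised squared distance in the denominator of `dipoleForm`. -/
noncomputable def dipoleDenom (δ : ℝ) (y x : Space3) : ℝ := ‖x - y‖ ^ 2 / 2 + δ

/-- A smooth one-form on `ℝ³` whose restriction to the sphere is a regularisation of the potential
`(y × x) · dx / (1 - x · y)` of the area form of the sphere minus `4π` times the Dirac mass at `y`.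
The coefficient is extended off the sphere so that the curl is radial on the sphere. -/
noncomputable def dipoleForm (δ : ℝ) (y x : Space3) : Space3 →L[ℝ] ℝ :=
  ((dipoleDenom δ y x)⁻¹ - (‖x‖ ^ 2 - 1) *
    ((dipoleDenom δ y x)⁻¹ / 2 + δ * (dipoleDenom δ y x)⁻¹ ^ 2 / 2)) • tripleForm y x

/-- The regularisation of `4π` times the Dirac mass on the sphere, as a function of `x · y`. -/
noncomputable def bubbleKernel (δ t : ℝ) : ℝ := δ * (2 + δ) / (1 - t + δ) ^ 2

theorem dipoleDenom_pos {δ : ℝ} (hδ : 0 < δ) (y x : Space3) : 0 < dipoleDenom δ y x := by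
  unfold dipoleDenom; positivity

theorem dipoleDenom_eq {δ : ℝ} {x y : Space3} (hx : ‖x‖ = 1) (hy : ‖y‖ = 1) :
    dipoleDenom δ y x = 1 - ⟪x, y⟫ + δ := by
  rw [dipoleDenom, norm_sub_sq_real, hx, hy]; ring

theorem contDiff_dipoleForm {δ : ℝ} (hδ : 0 < δ) (y : Space3) : ContDiff ℝ ∞ (dipoleForm δ y) := by
  have hD : ContDiff ℝ ∞ fun x => (dipoleDenom δ y x)⁻¹ := by
    refine ContDiff.inv ?_ fun x => (dipoleDenom_pos hδ y x).ne'
    unfold dipoleDenom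
    exact (((contDiff_id.sub contDiff_const).norm_sq ℝ).div_const 2).add contDiff_const
  unfold dipoleForm
  refine ContDiff.smul (𝕜' := ℝ) ?_ (tripleForm y).contDiff
  exact hD.sub (((contDiff_id.norm_sq ℝ).sub contDiff_const).mul
    ((hD.div_const 2).add ((contDiff_const.mul (hD.pow 2)).div_const 2)))

theorem dipoleForm_apply_of_norm_eq_one {δ : ℝ} {x : Space3} (hx : ‖x‖ = 1) (y v : Space3) :
    dipoleForm δ y x v = tripleForm y x v / (‖x - y‖ ^ 2 / 2 + δ) := by
  simp [dipoleForm, hx, dipoleDenom, div_eq_inv_mul]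

theorem fderiv_dipoleForm {δ : ℝ} (hδ : 0 < δ) {x : Space3} (hx : ‖x‖ = 1) (y v w : Space3) :
    fderiv ℝ (dipoleForm δ y) x v w =
      (dipoleDenom δ y x)⁻¹ * tripleForm y v w
      - ((dipoleDenom δ y x)⁻¹ ^ 2 * ⟪x - y, v⟫ + ((dipoleDenom δ y x)⁻¹
        + δ * (dipoleDenom δ y x)⁻¹ ^ 2) * ⟪x, v⟫) * tripleForm y x w := by
  have hD0 := (dipoleDenom_pos hδ y x).ne'
  have hD : HasFDerivAt (dipoleDenom δ y) (innerSL ℝ (x - y)) x := by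
    have h := (((hasFDerivAt_id x).sub_const y).norm_sq.mul_const (2 : ℝ)⁻¹).add_const δ
    refine h.congr_fderiv ?_
    ext z; simp
  have hI : HasFDerivAt (fun x => (dipoleDenom δ y x)⁻¹)
      (-((dipoleDenom δ y x) ^ 2)⁻¹ • innerSL ℝ (x - y)) x :=
    (hasDerivAt_inv hD0).comp_hasFDerivAt x hD
  have hr : DifferentiableAt ℝ (fun x => (dipoleDenom δ y x)⁻¹ / 2
      + δ * (dipoleDenom δ y x)⁻¹ ^ 2 / 2) x := by
    have hI' := hI.differentiableAt
    fun_prop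
  have hN : HasFDerivAt (fun x : Space3 => ‖x‖ ^ 2 - 1) (2 • innerSL ℝ x) x := by
    have h := (hasFDerivAt_id x).norm_sq.sub_const 1
    refine h.congr_fderiv ?_
    ext z; simp
  have hT : HasFDerivAt (fun x => tripleForm y x) (tripleForm y) x := (tripleForm y).hasFDerivAt
  have h := ((hI.sub (hN.mul hr.hasFDerivAt)).smul hT)
  have h' : HasFDerivAt (dipoleForm δ y) _ x := h
  rw [h'.fderiv]
  simp [hx, inner_sub_left]
  ring

/-- The curl of `dipoleForm` on the sphere. -/
theorem fderiv_dipoleForm_sub {δ : ℝ} (hδ : 0 < δ) {x y : Space3} (hx : ‖x‖ = 1) (hy : ‖y‖ = 1)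
    (v w : Space3) :
    fderiv ℝ (dipoleForm δ y) x v w - fderiv ℝ (dipoleForm δ y) x w v =
      (bubbleKernel δ ⟪x, y⟫ - 1) * tripleForm x v w := by
  rw [fderiv_dipoleForm hδ hx, fderiv_dipoleForm hδ hx, tripleForm_swap y v w]
  have h1 := inner_mul_tripleForm_sub (x - y) x y v w
  have h2 := inner_mul_tripleForm_sub x x y v w
  have hD0 := (dipoleDenom_pos hδ y x).ne'
  have hxx : ⟪x, x⟫ = 1 := by rw [real_inner_self_eq_norm_sq, hx]; norm_num
  have hyy : ⟪y, y⟫ = 1 := by rw [real_inner_self_eq_norm_sq, hy]; norm_num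
  rw [inner_sub_right, inner_sub_right, hxx, hyy] at h1
  rw [hxx] at h2
  have hDe := dipoleDenom_eq (δ := δ) hx hy
  rw [bubbleKernel, ← hDe]
  set D := dipoleDenom δ y x
  have ht : ⟪x, y⟫ = 1 + δ - D := by rw [hDe]; ring
  have ht' : ⟪y, x⟫ = 1 + δ - D := by rw [real_inner_comm, ht]
  rw [ht, ht'] at h1
  rw [ht'] at h2
  set a := tripleForm y v w
  set b := tripleForm x v w
  field_simp
  linear_combination (-1) * h1 - (D + δ) * h2

theorem abs_dipoleForm_le {δ : ℝ} (hδ : 0 ≤ δ) {x y : Space3} (hx : ‖x‖ = 1) (hy : ‖y‖ = 1)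
    (v : Space3) : |dipoleForm δ y x v| ≤ 2 * ‖x - y‖⁻¹ * ‖v‖ := by
  rw [dipoleForm_apply_of_norm_eq_one hx, abs_div]
  rcases eq_or_ne x y with rfl | hxy
  · have : tripleForm x x v = 0 := by simp only [tripleForm_eq]; ring
    simp [this]
  have hpos : 0 < ‖x - y‖ := norm_pos_iff.2 (sub_ne_zero.2 hxy)
  have h := abs_tripleForm_le_norm_sub y x v
  rw [hy, one_mul] at h
  have hD : 0 < ‖x - y‖ ^ 2 / 2 + δ := by positivity
  rw [abs_of_pos hD, div_le_iff₀ hD]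
  calc _ ≤ ‖x - y‖ * ‖v‖ := h
    _ = 2 * ‖x - y‖⁻¹ * ‖v‖ * (‖x - y‖ ^ 2 / 2) := by field_simp
    _ ≤ _ := by gcongr; linarith

end Kernel

section HatBox

open Set
open scoped RealInnerProductSpace Pointwise

theorem indicator_one_congr {α β : Type*} {s : Set α} {t : Set β} {a : α} {b : β}
    (h : a ∈ s ↔ b ∈ t) : (s.indicator 1 a : ℝ≥0∞) = t.indicator 1 b := by
  by_cases hb : b ∈ t
  · simp [hb, h.2 hb]
  · simp [hb, h.not.2 hb]

theorem volume_setOf_norm_sq_lt (r : ℝ) :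
    volume {w : Plane | ‖w‖ ^ 2 < r} = ENNReal.ofReal (Real.pi * max r 0) := by
  have h : {w : Plane | ‖w‖ ^ 2 < r} = Metric.ball 0 (Real.sqrt r) := by
    ext w
    rw [mem_ball_zero_iff, mem_ofPred_eq, Real.lt_sqrt (norm_nonneg _)]
  rw [h, EuclideanSpace.volume_ball_fin_two, ← ENNReal.ofReal_pow (Real.sqrt_nonneg r),
    ← ENNReal.ofReal_mul (sq_nonneg _), mul_comm]
  congr 2
  rcases le_total 0 r with hr | hr
  · rw [Real.sq_sqrt hr, max_eq_left hr]
  · rw [Real.sqrt_eq_zero_of_nonpos hr, max_eq_right hr]; norm_num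

/-- The area measure of the plane in terms of the squared distance to the origin. -/
theorem map_norm_sq_volume : Measure.map (fun w : Plane => ‖w‖ ^ 2) volume =
    ENNReal.ofReal Real.pi • volume.restrict (Ici 0) := by
  have hm : Measurable fun w : Plane => ‖w‖ ^ 2 := by fun_prop
  refine (Measure.ext_of_Ico' _ _ (fun {a b} _ => ?_) fun a b hab => ?_).symm
  · rw [Measure.smul_apply, smul_eq_mul]
    refine ENNReal.mul_ne_top ENNReal.ofReal_ne_top (ne_top_of_le_ne_top ?_
      (Measure.restrict_apply_le _ _))
    simp
  · rw [Measure.map_apply hm measurableSet_Ico, Measure.smul_apply,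
      Measure.restrict_apply measurableSet_Ico, smul_eq_mul]
    have h1 : (fun w : Plane => ‖w‖ ^ 2) ⁻¹' Ico a b =
        {w : Plane | ‖w‖ ^ 2 < b} \ {w : Plane | ‖w‖ ^ 2 < a} := by
      ext w; simp [and_comm]
    have h2 : Ico a b ∩ Ici 0 = Ico (max a 0) b := by
      ext t; simp [and_comm, and_left_comm]
    have hms : MeasurableSet {w : Plane | ‖w‖ ^ 2 < a} := hm measurableSet_Iio
    have hsub : {w : Plane | ‖w‖ ^ 2 < a} ⊆ {w : Plane | ‖w‖ ^ 2 < b} :=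
      fun w hw => lt_trans (show ‖w‖ ^ 2 < a from hw) hab
    rw [h1, measure_sdiff hsub hms.nullMeasurableSet
      (by rw [volume_setOf_norm_sq_lt]; exact ENNReal.ofReal_ne_top), volume_setOf_norm_sq_lt,
      volume_setOf_norm_sq_lt, ← ENNReal.ofReal_sub _ (by positivity), h2, Real.volume_Ico,
      ← ENNReal.ofReal_mul Real.pi_pos.le, ← mul_sub]
    rcases le_total 0 b with hb | hb
    · rw [max_eq_left hb]
    · rw [max_eq_right hb, max_eq_right (hab.le.trans hb),
        ENNReal.ofReal_of_nonpos (p := Real.pi * (b - 0)) (by nlinarith [Real.pi_pos])]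
      simp

/-- Orthogonal coordinates of space with first coordinate along a given unit vector. -/
theorem exists_measurePreserving_axis {x : Space3} (hx : ‖x‖ = 1) :
    ∃ Ψ : Space3 → ℝ × Plane, MeasurePreserving Ψ volume volume ∧
      (∀ z, (Ψ z).1 = ⟪x, z⟫) ∧ ∀ z, ‖z‖ ^ 2 = (Ψ z).1 ^ 2 + ‖(Ψ z).2‖ ^ 2 := by
  obtain ⟨b, hb⟩ := Orthonormal.exists_orthonormalBasis_extension_of_card_eq (𝕜 := ℝ)
    (E := Space3) (ι := Fin 3) (by simp) (v := fun _ => x) (s := {0})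
    (by
      rw [orthonormal_iff_ite]
      rintro ⟨i, rfl⟩ ⟨j, rfl⟩
      simp [hx])
  have hb0 : b 0 = x := hb 0 rfl
  refine ⟨Prod.map id (WithLp.toLp 2) ∘ MeasurableEquiv.piFinSuccAbove (fun _ => ℝ) 0 ∘
    WithLp.ofLp ∘ b.repr, ?_, ?_, ?_⟩
  · exact ((MeasurePreserving.id volume).prod (PiLp.volume_preserving_toLp (Fin 2))).comp
      ((volume_preserving_piFinSuccAbove (fun _ => ℝ) 0).comp
        ((PiLp.volume_preserving_ofLp (Fin 3)).comp b.measurePreserving_repr))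
  · intro z
    rw [← hb0, ← b.repr_apply_apply]
    simp [MeasurableEquiv.piFinSuccAbove]
  · intro z
    rw [← b.repr.norm_map z, EuclideanSpace.norm_sq_eq, EuclideanSpace.norm_sq_eq,
      Fin.sum_univ_three, Fin.sum_univ_two]
    simp [MeasurableEquiv.piFinSuccAbove, Fin.tail, add_assoc]

theorem smul_image_preimage_inner (x : Space3) (B : Set ℝ) :
    Ioo (0 : ℝ) 1 • (Subtype.val '' ((fun y : UnitSphere => ⟪x, (y : Space3)⟫) ⁻¹' B)) =
      {z : Space3 | 0 < ‖z‖ ^ 2 ∧ ‖z‖ ^ 2 < 1 ∧ ⟪x, z⟫ / Real.sqrt (‖z‖ ^ 2) ∈ B} := by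
  ext z
  rw [Set.mem_smul]
  constructor
  · rintro ⟨r, ⟨hr0, hr1⟩, _, ⟨y, hy, rfl⟩, rfl⟩
    have hy1 : ‖(y : Space3)‖ = 1 := mem_sphere_zero_iff_norm.1 y.2
    have hn : ‖r • (y : Space3)‖ = r := by rw [norm_smul, hy1, mul_one, Real.norm_of_nonneg hr0.le]
    refine ⟨by rw [hn]; positivity, by rw [hn]; nlinarith, ?_⟩
    rw [hn, Real.sqrt_sq hr0.le, inner_smul_right, mul_div_cancel_left₀ _ hr0.ne']
    exact hy
  · rintro ⟨h0, h1, hB⟩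
    rw [Real.sqrt_sq (norm_nonneg z)] at hB
    have hz0 : 0 < ‖z‖ := by
      rcases (norm_nonneg z).eq_or_lt with h | h
      · simp [← h] at h0
      · exact h
    refine ⟨‖z‖, ⟨hz0, by nlinarith⟩, ‖z‖⁻¹ • z, ⟨⟨‖z‖⁻¹ • z, ?_⟩, ?_, rfl⟩, ?_⟩
    · rw [mem_sphere_zero_iff_norm, norm_smul, norm_inv, norm_norm, inv_mul_cancel₀ hz0.ne']
    · change ⟪x, ‖z‖⁻¹ • z⟫ ∈ B
      rw [inner_smul_right, ← div_eq_inv_mul]; exact hB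
    · exact smul_inv_smul₀ hz0.ne' z

theorem lintegral_sqrt_Ioo : ∫⁻ v in Ioo (0 : ℝ) 1, ENNReal.ofReal (Real.sqrt v) =
    ENNReal.ofReal (2 / 3) := by
  rw [← ofReal_integral_eq_lintegral_ofReal, ← integral_Ioc_eq_integral_Ioo,
    ← intervalIntegral.integral_of_le zero_le_one]
  · congr 1
    simp_rw [Real.sqrt_eq_rpow]
    rw [integral_rpow (Or.inl (by norm_num))]
    norm_num
  · exact (Real.continuous_sqrt.integrableOn_Icc (a := 0) (b := 1)).mono_set Ioo_subset_Icc_self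
  · exact Filter.Eventually.of_forall fun v => Real.sqrt_nonneg v

/-- Archimedes' hat-box theorem. -/
theorem map_inner_sphereArea {x : Space3} (hx : ‖x‖ = 1) :
    Measure.map (fun y : UnitSphere => ⟪x, (y : Space3)⟫) sphereArea =
      ENNReal.ofReal (2 * Real.pi) • volume.restrict (Icc (-1) 1) := by
  have hm : Measurable fun y : UnitSphere => ⟪x, (y : Space3)⟫ := by fun_prop
  ext B hB
  rw [Measure.map_apply hm hB, sphereArea, Measure.toSphere_apply' _ (hm hB),
    smul_image_preimage_inner]
  obtain ⟨Ψ, hΨ, hΨ1, hΨ2⟩ := exists_measurePreserving_axis hx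
  let R : Set (ℝ × ℝ) := {q | 0 < q.1 ^ 2 + q.2 ∧ q.1 ^ 2 + q.2 < 1 ∧
    q.1 / Real.sqrt (q.1 ^ 2 + q.2) ∈ B}
  have hR : MeasurableSet R := by
    have hm1 : Measurable fun q : ℝ × ℝ => q.1 ^ 2 + q.2 := by fun_prop
    refine (measurableSet_lt measurable_const hm1).inter
      ((measurableSet_lt hm1 measurable_const).inter ?_)
    exact (show Measurable fun q : ℝ × ℝ => q.1 / Real.sqrt (q.1 ^ 2 + q.2) by fun_prop) hB
  have hmap : Measurable (Prod.map id (fun w : Plane => ‖w‖ ^ 2) : ℝ × Plane → ℝ × ℝ) := by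
    fun_prop
  have hset : {z : Space3 | 0 < ‖z‖ ^ 2 ∧ ‖z‖ ^ 2 < 1 ∧ ⟪x, z⟫ / Real.sqrt (‖z‖ ^ 2) ∈ B} =
      Ψ ⁻¹' (Prod.map id (fun w : Plane => ‖w‖ ^ 2) ⁻¹' R) := by
    ext z
    simp [R, hΨ2, ← hΨ1]
  rw [hset, hΨ.measure_preimage (hmap hR).nullMeasurableSet, ← Measure.map_apply hmap hR,
    Measure.volume_eq_prod, ← Measure.map_prod_map _ _ measurable_id (by fun_prop),
    Measure.map_id, map_norm_sq_volume, Measure.prod_smul_right, Measure.smul_apply,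
    Measure.prod_apply hR]
  let S : Set (ℝ × ℝ) := {q | q.1 ^ 2 ≤ q.2 ∧ 0 < q.2 ∧ q.2 < 1 ∧ q.1 / Real.sqrt q.2 ∈ B}
  have hinner : ∀ s : ℝ, (volume.restrict (Ici 0)) (Prod.mk s ⁻¹' R) =
      ∫⁻ v, S.indicator 1 (s, v) := by
    intro s
    rw [Measure.restrict_apply (measurable_prodMk_left hR),
      ← lintegral_indicator_one ((measurable_prodMk_left hR).inter measurableSet_Ici),
      ← lintegral_sub_right_eq_self _ (s ^ 2)]
    refine lintegral_congr fun v => ?_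
    have hiff : v - s ^ 2 ∈ Prod.mk s ⁻¹' R ∩ Ici 0 ↔ (s, v) ∈ S := by
      change (0 < s ^ 2 + (v - s ^ 2) ∧ s ^ 2 + (v - s ^ 2) < 1 ∧
        s / Real.sqrt (s ^ 2 + (v - s ^ 2)) ∈ B) ∧ 0 ≤ v - s ^ 2 ↔
        s ^ 2 ≤ v ∧ 0 < v ∧ v < 1 ∧ s / Real.sqrt v ∈ B
      rw [add_sub_cancel, sub_nonneg]
      tauto
    exact indicator_one_congr hiff
  simp_rw [hinner]
  have hR' : MeasurableSet S := by
    refine (measurableSet_le (measurable_fst.pow_const 2) measurable_snd).inter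
      ((measurableSet_lt measurable_const measurable_snd).inter
      ((measurableSet_lt measurable_snd measurable_const).inter ?_))
    exact (show Measurable fun q : ℝ × ℝ => q.1 / Real.sqrt q.2 by fun_prop) hB
  rw [lintegral_lintegral_swap (f := fun s v => S.indicator 1 (s, v))
    ((measurable_one.indicator hR').aemeasurable)]
  have hslice : ∀ v : ℝ, ∫⁻ s, S.indicator 1 (s, v) =
      (Ioo (0 : ℝ) 1).indicator (fun v => ENNReal.ofReal (Real.sqrt v) *
        volume (B ∩ Icc (-1) 1)) v := by
    intro v
    by_cases hv : v ∈ Ioo (0 : ℝ) 1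
    · rw [indicator_of_mem hv]
      have hsv : 0 < Real.sqrt v := Real.sqrt_pos.2 hv.1
      have h1 : ∀ s : ℝ, (S.indicator 1 (s, v) : ℝ≥0∞) =
          (((Real.sqrt v)⁻¹ * ·) ⁻¹' (B ∩ Icc (-1) 1)).indicator 1 s := by
        intro s
        have hiff : (s, v) ∈ S ↔ s ∈ ((Real.sqrt v)⁻¹ * ·) ⁻¹' (B ∩ Icc (-1) 1) := by
          change s ^ 2 ≤ v ∧ 0 < v ∧ v < 1 ∧ s / Real.sqrt v ∈ B ↔
            (Real.sqrt v)⁻¹ * s ∈ B ∧ -1 ≤ (Real.sqrt v)⁻¹ * s ∧ (Real.sqrt v)⁻¹ * s ≤ 1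
          rw [← div_eq_inv_mul, ← abs_le, abs_div, abs_of_pos hsv, div_le_one hsv,
            ← Real.sqrt_sq_eq_abs, Real.sqrt_le_sqrt_iff hv.1.le]
          have := hv.1
          have := hv.2
          tauto
        exact indicator_one_congr hiff
      simp_rw [h1]
      rw [lintegral_indicator_one ((measurable_const_mul _) (hB.inter measurableSet_Icc)),
        Real.volume_preimage_mul_left (inv_ne_zero hsv.ne'), inv_inv, abs_of_pos hsv]
    · rw [indicator_of_notMem hv]
      refine (lintegral_congr fun s => ?_).trans lintegral_zero
      rw [indicator_of_notMem]
      rintro ⟨_, h0, h1, _⟩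
      exact hv ⟨h0, h1⟩
  simp_rw [hslice]
  rw [lintegral_indicator measurableSet_Ioo, lintegral_mul_const _ (by fun_prop),
    lintegral_sqrt_Ioo, Measure.smul_apply, Measure.restrict_apply hB, smul_eq_mul, smul_eq_mul,
    ← mul_assoc, ← mul_assoc]
  congr 1
  have h3 : ((Module.finrank ℝ Space3 : ℕ) : ℝ≥0∞) = ENNReal.ofReal 3 := by simp
  rw [h3, ← ENNReal.ofReal_mul (by norm_num), ← ENNReal.ofReal_mul (by positivity)]
  congr 1
  ring

end HatBox

section SphereIntegrals

open Set Filter Topology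
open scoped RealInnerProductSpace BoundedContinuousFunction

instance : IsFiniteMeasure sphereArea := by unfold sphereArea; infer_instance

theorem norm_coe_unitSphere (y : UnitSphere) : ‖(y : Space3)‖ = 1 := mem_sphere_zero_iff_norm.1 y.2

theorem norm_sub_eq_sqrt {x : Space3} (hx : ‖x‖ = 1) (y : UnitSphere) :
    ‖x - y‖ = Real.sqrt (2 - 2 * ⟪x, (y : Space3)⟫) := by
  rw [← Real.sqrt_sq (norm_nonneg (x - (y : Space3))), norm_sub_sq_real, hx, norm_coe_unitSphere]
  congr 1
  ring

theorem inner_le_one_unitSphere {x : Space3} (hx : ‖x‖ = 1) (y : UnitSphere) :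
    ⟪x, (y : Space3)⟫ ≤ 1 := by
  have := real_inner_le_norm x (y : Space3)
  rwa [hx, norm_coe_unitSphere, one_mul] at this

theorem lintegral_comp_inner {x : Space3} (hx : ‖x‖ = 1) {F : ℝ → ℝ≥0∞} (hF : Measurable F) :
    ∫⁻ y, F ⟪x, (y : Space3)⟫ ∂sphereArea =
      ENNReal.ofReal (2 * Real.pi) * ∫⁻ t in Icc (-1) 1, F t := by
  have hm : Measurable fun y : UnitSphere => ⟪x, (y : Space3)⟫ := by fun_prop
  rw [← lintegral_map hF hm, map_inner_sphereArea hx, lintegral_smul_measure, smul_eq_mul]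

theorem integral_comp_inner {x : Space3} (hx : ‖x‖ = 1) {F : ℝ → ℝ} (hF : Measurable F) :
    ∫ y, F ⟪x, (y : Space3)⟫ ∂sphereArea = 2 * Real.pi * ∫ t in (-1)..1, F t := by
  have hm : Measurable fun y : UnitSphere => ⟪x, (y : Space3)⟫ := by fun_prop
  rw [← integral_map hm.aemeasurable hF.aestronglyMeasurable, map_inner_sphereArea hx,
    integral_smul_measure, ENNReal.toReal_ofReal (by positivity),
    intervalIntegral.integral_of_le (by norm_num), integral_Icc_eq_integral_Ioc, smul_eq_mul]

theorem measurable_bubbleKernel (δ : ℝ) : Measurable (bubbleKernel δ) := by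
  unfold bubbleKernel; fun_prop

theorem bubbleKernel_nonneg {δ : ℝ} (hδ : 0 ≤ δ) (t : ℝ) : 0 ≤ bubbleKernel δ t := by
  unfold bubbleKernel; positivity

theorem intervalIntegral_bubbleKernel {δ : ℝ} (hδ : 0 < δ) :
    ∫ t in (-1)..1, bubbleKernel δ t = 2 := by
  have hne : ∀ t ∈ uIcc (-1 : ℝ) 1, 1 - t + δ ≠ 0 := by
    intro t ht
    rw [uIcc_of_le (by norm_num)] at ht
    have := ht.2
    linarith
  have hd : ∀ t ∈ uIcc (-1 : ℝ) 1,
      HasDerivAt (fun t => δ * (2 + δ) / (1 - t + δ)) (bubbleKernel δ t) t := by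
    intro t ht
    have h1 : HasDerivAt (fun t : ℝ => 1 - t + δ) (-1) t :=
      ((hasDerivAt_id t).const_sub 1).add_const δ
    refine ((hasDerivAt_const t (δ * (2 + δ))).div h1 (hne t ht)).congr_deriv ?_
    rw [bubbleKernel]; ring
  rw [intervalIntegral.integral_eq_sub_of_hasDerivAt hd]
  · have : (2 : ℝ) + δ ≠ 0 := by linarith
    have h3 : (1 : ℝ) - -1 + δ = 2 + δ := by ring
    rw [h3, sub_self, zero_add]
    field_simp
    ring
  · refine ContinuousOn.intervalIntegrable ?_
    unfold bubbleKernel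
    exact continuousOn_const.div (by fun_prop) fun t ht => pow_ne_zero 2 (hne t ht)

theorem integral_bubbleKernel {δ : ℝ} (hδ : 0 < δ) {x : Space3} (hx : ‖x‖ = 1) :
    ∫ y, bubbleKernel δ ⟪x, (y : Space3)⟫ ∂sphereArea = 4 * Real.pi := by
  rw [integral_comp_inner hx (measurable_bubbleKernel δ), intervalIntegral_bubbleKernel hδ]
  ring

theorem integrable_bubbleKernel {δ : ℝ} (hδ : 0 < δ) {x : Space3} (hx : ‖x‖ = 1) :
    Integrable (fun y : UnitSphere => bubbleKernel δ ⟪x, (y : Space3)⟫) sphereArea := by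
  refine Integrable.of_integral_ne_zero ?_
  rw [integral_bubbleKernel hδ hx]
  positivity

theorem sphereArea_univ : sphereArea univ = ENNReal.ofReal (4 * Real.pi) := by
  obtain ⟨x⟩ : Nonempty UnitSphere :=
    ⟨⟨EuclideanSpace.single 0 1, mem_sphere_zero_iff_norm.2 (by simp)⟩⟩
  have h := lintegral_comp_inner (norm_coe_unitSphere x) (F := fun _ => 1) measurable_const
  simp only [lintegral_one, Measure.restrict_apply_univ, Real.volume_Icc] at h
  rw [h, ← ENNReal.ofReal_mul (by positivity)]
  congr 1
  ring

/-- The kernels `bubbleKernel δ` concentrate at the point with mass `4π`. -/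
theorem tendsto_integral_bubbleKernel {x : Space3} (hx : ‖x‖ = 1) (f : Space3 →ᵇ ℝ) :
    Tendsto (fun δ : ℝ => ∫ y, bubbleKernel δ ⟪x, (y : Space3)⟫ * f y ∂sphereArea) (𝓝[>] 0)
      (𝓝 (4 * Real.pi * f x)) := by
  let x₀ : UnitSphere := ⟨x, mem_sphere_zero_iff_norm.2 hx⟩
  have hπ : (0 : ℝ) < 4 * Real.pi := by positivity
  have key := tendsto_integral_peak_smul_of_integrable_of_tendsto (μ := sphereArea)
    (φ := fun (δ : ℝ) (y : UnitSphere) => (4 * Real.pi)⁻¹ * bubbleKernel δ ⟪x, (y : Space3)⟫)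
    (l := 𝓝[>] (0 : ℝ)) (x₀ := x₀) (g := fun y : UnitSphere => f y) (a := f x) (t := univ)
    MeasurableSet.univ univ_mem (measure_ne_top _ _) ?_ ?_ ?_ ?_ ?_ ?_
  · have h := key.const_mul (4 * Real.pi)
    refine h.congr fun δ => ?_
    rw [← integral_const_mul]
    congr 1
    ext y
    rw [smul_eq_mul]
    field_simp
  · filter_upwards [self_mem_nhdsWithin] with δ hδ y
    exact mul_nonneg (by positivity) (bubbleKernel_nonneg (le_of_lt hδ) _)
  · intro u hu hxu
    obtain ⟨r, hr, hru⟩ := Metric.isOpen_iff.1 hu x₀ hxu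
    rw [Metric.tendstoUniformlyOn_iff]
    intro ε hε
    have hlim : Tendsto (fun δ : ℝ => (4 * Real.pi)⁻¹ * (δ * (2 + δ) / (r ^ 2 / 2) ^ 2))
        (𝓝[>] 0) (𝓝 0) := by
      have : Continuous fun δ : ℝ => (4 * Real.pi)⁻¹ * (δ * (2 + δ) / (r ^ 2 / 2) ^ 2) := by
        fun_prop
      simpa using (this.tendsto 0).mono_left nhdsWithin_le_nhds
    filter_upwards [self_mem_nhdsWithin, hlim.eventually_lt_const hε] with δ hδ hlt y hy
    have hδ' : 0 < δ := hδ
    have hry : r ≤ ‖x - y‖ := by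
      by_contra hlt'
      refine hy (hru ?_)
      rw [Metric.mem_ball, dist_comm, Subtype.dist_eq, dist_eq_norm]
      exact not_le.1 hlt'
    have h1 : r ^ 2 / 2 ≤ 1 - ⟪x, (y : Space3)⟫ + δ := by
      have h2 := norm_sub_sq_real x (y : Space3)
      rw [hx, norm_coe_unitSphere] at h2
      nlinarith
    have h0 : (0 : ℝ) < r ^ 2 / 2 := by positivity
    rw [Pi.zero_apply, dist_zero_left, Real.norm_of_nonneg
      (mul_nonneg (inv_nonneg.2 hπ.le) (bubbleKernel_nonneg hδ'.le _))]
    refine lt_of_le_of_lt ?_ hlt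
    unfold bubbleKernel
    gcongr
  · refine (tendsto_congr' ?_).2 tendsto_const_nhds
    filter_upwards [self_mem_nhdsWithin] with δ hδ
    rw [setIntegral_univ, integral_const_mul, integral_bubbleKernel hδ hx,
      inv_mul_cancel₀ hπ.ne']
  · exact Eventually.of_forall fun δ =>
      (((measurable_bubbleKernel δ).comp (by fun_prop)).const_mul _).aestronglyMeasurable
  · exact (f.compContinuous ⟨_, continuous_subtype_val⟩).integrable sphereArea
  · exact (f.continuous.comp continuous_subtype_val).tendsto x₀

theorem intervalIntegral_sqrt_inv {r : ℝ} (hr : 0 ≤ r) :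
    ∫ t in (1 - r ^ 2 / 2)..1, (2 - 2 * t) ^ (-(1 / 2) : ℝ) = r := by
  rw [intervalIntegral.integral_comp_sub_mul (fun u : ℝ => u ^ (-(1 / 2) : ℝ)) two_ne_zero 2,
    integral_rpow (Or.inl (by norm_num))]
  have h1 : (2 : ℝ) - 2 * 1 = 0 := by norm_num
  have h2 : (2 : ℝ) - 2 * (1 - r ^ 2 / 2) = r ^ 2 := by ring
  have h3 : (-(1 / 2) + 1 : ℝ) = 1 / 2 := by norm_num
  rw [h1, h2, h3, ← Real.sqrt_eq_rpow, ← Real.sqrt_eq_rpow, Real.sqrt_sq hr, Real.sqrt_zero,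
    smul_eq_mul]
  ring

theorem intervalIntegrable_sqrt_inv (r : ℝ) :
    IntervalIntegrable (fun t : ℝ => (2 - 2 * t) ^ (-(1 / 2) : ℝ)) volume (1 - r ^ 2 / 2) 1 := by
  have h := (intervalIntegral.intervalIntegrable_rpow' (a := r ^ 2) (b := 0) (r := (-(1 / 2) : ℝ))
    (by norm_num)).comp_sub_left 2
  have h' := h.comp_mul_left (c := 2)
  convert h' using 1 <;> ring

/-- The singular kernel `1 / |x - y|`, integrated over a small disc of the sphere. -/
theorem lintegral_norm_sub_inv_near {x : Space3} (hx : ‖x‖ = 1) {r : ℝ} (hr : 0 ≤ r) :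
    ∫⁻ y, {y : UnitSphere | ‖x - y‖ ≤ r}.indicator (fun y => ENNReal.ofReal ‖x - y‖⁻¹) y
      ∂sphereArea ≤ ENNReal.ofReal (2 * Real.pi * r) := by
  let F : ℝ → ℝ≥0∞ := (Ici (1 - r ^ 2 / 2)).indicator
    fun t => ENNReal.ofReal ((2 - 2 * t) ^ (-(1 / 2) : ℝ))
  have hF : Measurable F := Measurable.indicator (by fun_prop) measurableSet_Ici
  have h1 : ∀ y : UnitSphere, {y : UnitSphere | ‖x - y‖ ≤ r}.indicator
      (fun y => ENNReal.ofReal ‖x - y‖⁻¹) y ≤ F ⟪x, (y : Space3)⟫ := by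
    intro y
    by_cases hy' : ‖x - y‖ ≤ r
    swap
    · rw [indicator_of_notMem (by exact hy')]
      exact zero_le
    rw [indicator_of_mem (by exact hy')]
    have hmem : ⟪x, (y : Space3)⟫ ∈ Ici (1 - r ^ 2 / 2) := by
      have h2 := norm_sub_sq_real x (y : Space3)
      rw [hx, norm_coe_unitSphere] at h2
      have := norm_nonneg (x - (y : Space3))
      rw [mem_Ici]
      nlinarith
    simp only [F, indicator_of_mem hmem]
    rw [norm_sub_eq_sqrt hx, Real.rpow_neg (by linarith [inner_le_one_unitSphere hx y]),
      Real.sqrt_eq_rpow]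
  refine (lintegral_mono h1).trans ?_
  rw [lintegral_comp_inner hx hF, ENNReal.ofReal_mul (p := 2 * Real.pi) (by positivity)]
  refine mul_le_mul_right ?_ _
  rw [lintegral_indicator measurableSet_Ici, Measure.restrict_restrict measurableSet_Ici]
  have hsub : Ici (1 - r ^ 2 / 2) ∩ Icc (-1) 1 ⊆ Icc (1 - r ^ 2 / 2) 1 :=
    fun t ht => ⟨ht.1, ht.2.2⟩
  refine (lintegral_mono_set hsub).trans ?_
  have hle : 1 - r ^ 2 / 2 ≤ 1 := by nlinarith [sq_nonneg r]
  have hi := (intervalIntegrable_iff_integrableOn_Icc_of_le hle).1 (intervalIntegrable_sqrt_inv r)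
  rw [← ofReal_integral_eq_lintegral_ofReal hi, integral_Icc_eq_integral_Ioc,
    ← intervalIntegral.integral_of_le hle, intervalIntegral_sqrt_inv hr]
  filter_upwards [ae_restrict_mem measurableSet_Icc] with t ht
  have := ht.2
  exact Real.rpow_nonneg (by linarith) _

/-- The logarithmic gradient kernel, integrated over a set of given area. -/
theorem lintegral_norm_sub_inv_le {x : Space3} (hx : ‖x‖ = 1) (A : Set UnitSphere)
    (hA0 : 0 < area A) :
    ∫⁻ y in A, ENNReal.ofReal ‖x - y‖⁻¹ ∂sphereArea ≤
      ENNReal.ofReal ((2 * Real.pi + 1) * Real.sqrt (area A)) := by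
  set r := Real.sqrt (area A) with hr
  have hr0 : 0 < r := Real.sqrt_pos.2 hA0
  have hpt : ∀ y : UnitSphere, ENNReal.ofReal ‖x - y‖⁻¹ ≤ {y : UnitSphere | ‖x - y‖ ≤ r}.indicator
      (fun y => ENNReal.ofReal ‖x - y‖⁻¹) y + ENNReal.ofReal r⁻¹ := by
    intro y
    by_cases hy : ‖x - y‖ ≤ r
    · rw [indicator_of_mem (by exact hy)]
      exact le_self_add
    · refine le_add_left (ENNReal.ofReal_le_ofReal ?_)
      exact inv_anti₀ hr0 (not_le.1 hy).le
  calc ∫⁻ y in A, ENNReal.ofReal ‖x - y‖⁻¹ ∂sphereArea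
      ≤ ∫⁻ y in A, ({y : UnitSphere | ‖x - y‖ ≤ r}.indicator
        (fun y => ENNReal.ofReal ‖x - y‖⁻¹) y + ENNReal.ofReal r⁻¹) ∂sphereArea :=
        lintegral_mono hpt
    _ = (∫⁻ y in A, {y : UnitSphere | ‖x - y‖ ≤ r}.indicator
        (fun y => ENNReal.ofReal ‖x - y‖⁻¹) y ∂sphereArea) + ENNReal.ofReal r⁻¹ * sphereArea A := by
        rw [lintegral_add_right _ measurable_const, lintegral_const, Measure.restrict_apply_univ]
    _ ≤ ENNReal.ofReal (2 * Real.pi * r) + ENNReal.ofReal r := by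
        refine add_le_add ((setLIntegral_le_lintegral _ _).trans
          (lintegral_norm_sub_inv_near hx hr0.le)) ?_
        rw [← ENNReal.ofReal_toReal (measure_ne_top sphereArea A),
          ← ENNReal.ofReal_mul (by positivity)]
        refine ENNReal.ofReal_le_ofReal (le_of_eq ?_)
        change r⁻¹ * area A = r
        rw [← Real.mul_self_sqrt hA0.le, ← hr]
        field_simp
    _ = _ := by
        rw [← ENNReal.ofReal_add (by positivity) hr0.le]
        congr 1
        ring

end SphereIntegrals

section Uniqueness

open Set Filter Topology
open scoped BoundedContinuousFunction

variable {Z Z' E : Type*} [MeasurableSpace Z] [MeasurableSpace Z'] {m : Measure Z} {m' : Measure Z'}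
  [MeasurableSpace E]

/-- Integration against the push-forward of the signed measure `Ψ m` under `φ`. -/
theorem integral_comp_mul_eq_integral_map_sub {φ : Z → E} (hφ : AEMeasurable φ m) {Ψ : Z → ℝ}
    (hΨ : Integrable Ψ m) {g : E → ℝ} (hg : StronglyMeasurable g) {C : ℝ} (hC : ∀ e, |g e| ≤ C) :
    ∫ z, g (φ z) * Ψ z ∂m =
      ∫ e, g e ∂(Measure.map φ (m.withDensity fun z => ENNReal.ofReal (Ψ z)))
      - ∫ e, g e ∂(Measure.map φ (m.withDensity fun z => ENNReal.ofReal (-Ψ z))) := by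
  have key : ∀ Θ : Z → ℝ, Integrable Θ m →
      ∫ e, g e ∂(Measure.map φ (m.withDensity fun z => ENNReal.ofReal (Θ z))) =
        ∫ z, max (Θ z) 0 * g (φ z) ∂m := by
    intro Θ hΘ
    rw [integral_map (hφ.mono_ac (withDensity_absolutelyContinuous _ _))
      hg.aestronglyMeasurable, integral_withDensity_eq_integral_toReal_smul₀
        hΘ.1.aemeasurable.ennreal_ofReal (Eventually.of_forall fun _ => ENNReal.ofReal_lt_top)]
    simp only [ENNReal.toReal_ofReal', smul_eq_mul]
  have hint : ∀ Θ : Z → ℝ, Integrable Θ m → Integrable (fun z => max (Θ z) 0 * g (φ z)) m :=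
    fun Θ hΘ => hΘ.pos_part.mul_bdd (c := C)
      (hg.aestronglyMeasurable.comp_aemeasurable hφ) (Eventually.of_forall fun z => hC (φ z))
  rw [key _ hΨ, key (fun z => -Ψ z) hΨ.neg,
    ← integral_sub (hint _ hΨ) (hint (fun z => -Ψ z) hΨ.neg)]
  refine integral_congr_ae (Eventually.of_forall fun z => ?_)
  have : max (Ψ z) 0 - max (-Ψ z) 0 = Ψ z := max_zero_sub_max_neg_zero_eq_self (Ψ z)
  change g (φ z) * Ψ z = max (Ψ z) 0 * g (φ z) - max (-Ψ z) 0 * g (φ z)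
  rw [← sub_mul, this, mul_comm]

theorem isFiniteMeasure_map_withDensity_ofReal (φ : Z → E) {Ψ : Z → ℝ} (hΨ : Integrable Ψ m) :
    IsFiniteMeasure (Measure.map φ (m.withDensity fun z => ENNReal.ofReal (Ψ z))) := by
  have := isFiniteMeasure_withDensity_ofReal hΨ.2
  infer_instance

/-- Two push-forwards of signed measures that agree on bounded continuous functions agree on
measurable sets. -/
theorem integral_indicator_comp_eq_of_forall_boundedContinuous [TopologicalSpace E]
    [BorelSpace E] [HasOuterApproxClosed E]
    {φ : Z → E} (hφ : AEMeasurable φ m) {Ψ : Z → ℝ} (hΨ : Integrable Ψ m)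
    {φ' : Z' → E} (hφ' : AEMeasurable φ' m') {Ψ' : Z' → ℝ} (hΨ' : Integrable Ψ' m')
    (h : ∀ f : E →ᵇ ℝ, ∫ z, f (φ z) * Ψ z ∂m = ∫ z, f (φ' z) * Ψ' z ∂m')
    {A : Set E} (hA : MeasurableSet A) :
    ∫ z, A.indicator 1 (φ z) * Ψ z ∂m = ∫ z, A.indicator 1 (φ' z) * Ψ' z ∂m' := by
  have i1 := isFiniteMeasure_map_withDensity_ofReal φ hΨ
  have i2 := isFiniteMeasure_map_withDensity_ofReal φ (Ψ := fun z => -Ψ z) hΨ.neg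
  have i3 := isFiniteMeasure_map_withDensity_ofReal φ' hΨ'
  have i4 := isFiniteMeasure_map_withDensity_ofReal φ' (Ψ := fun z => -Ψ' z) hΨ'.neg
  set a := Measure.map φ (m.withDensity fun z => ENNReal.ofReal (Ψ z))
  set b := Measure.map φ (m.withDensity fun z => ENNReal.ofReal (-Ψ z))
  set a' := Measure.map φ' (m'.withDensity fun z => ENNReal.ofReal (Ψ' z))
  set b' := Measure.map φ' (m'.withDensity fun z => ENNReal.ofReal (-Ψ' z))
  have hm : a + b' = a' + b := by
    refine ext_of_forall_integral_eq_of_IsFiniteMeasure fun f => ?_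
    have hf := h f
    rw [integral_comp_mul_eq_integral_map_sub hφ hΨ f.continuous.stronglyMeasurable
        (fun e => f.norm_coe_le_norm e),
      integral_comp_mul_eq_integral_map_sub hφ' hΨ' f.continuous.stronglyMeasurable
        (fun e => f.norm_coe_le_norm e)] at hf
    rw [integral_add_measure (f.integrable _) (f.integrable _),
      integral_add_measure (f.integrable _) (f.integrable _)]
    linarith
  have hgm : StronglyMeasurable (A.indicator (1 : E → ℝ)) :=
    stronglyMeasurable_one.indicator hA
  have hg1 : ∀ e, |A.indicator (1 : E → ℝ) e| ≤ 1 := fun e => by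
    by_cases he : e ∈ A <;> simp [he]
  have hgi : ∀ (k : Measure E) [IsFiniteMeasure k], Integrable (A.indicator (1 : E → ℝ)) k :=
    fun k _ => (integrable_const (1 : ℝ)).indicator hA
  have hI := congrArg (fun k => ∫ e, A.indicator (1 : E → ℝ) e ∂k) hm
  beta_reduce at hI
  rw [integral_add_measure (hgi a) (hgi b'), integral_add_measure (hgi a') (hgi b)] at hI
  rw [integral_comp_mul_eq_integral_map_sub hφ hΨ hgm hg1,
    integral_comp_mul_eq_integral_map_sub hφ' hΨ' hgm hg1]
  linarith

end Uniqueness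

section DipoleKernel

open Set Filter Topology
open scoped RealInnerProductSpace

/-- The regularised dipole potential at `x`, with pole at `y`, applied to a tangent vector `v`. -/
noncomputable def dipoleKernel (δ : ℝ) (y x v : Space3) : ℝ :=
  tripleForm y x v / (‖x - y‖ ^ 2 / 2 + δ)

theorem Measurable.tripleForm {α : Type*} [MeasurableSpace α] {f g h : α → Space3}
    (hf : Measurable f) (hg : Measurable g) (hh : Measurable h) :
    Measurable fun a => tripleForm (f a) (g a) (h a) := by
  simp_rw [tripleForm_eq]
  fun_prop

theorem Measurable.dipoleKernel {α : Type*} [MeasurableSpace α] {f g h : α → Space3} (δ : ℝ)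
    (hf : Measurable f) (hg : Measurable g) (hh : Measurable h) :
    Measurable fun a => dipoleKernel δ (f a) (g a) (h a) := by
  unfold _root_.dipoleKernel
  exact (hf.tripleForm hg hh).div (by fun_prop)

theorem AEMeasurable.tripleForm {α : Type*} [MeasurableSpace α] {m : Measure α}
    {f g h : α → Space3} (hf : AEMeasurable f m) (hg : AEMeasurable g m) (hh : AEMeasurable h m) :
    AEMeasurable (fun a => tripleForm (f a) (g a) (h a)) m := by
  refine ⟨_, hf.measurable_mk.tripleForm hg.measurable_mk hh.measurable_mk, ?_⟩
  filter_upwards [hf.ae_eq_mk, hg.ae_eq_mk, hh.ae_eq_mk] with a h1 h2 h3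
  rw [h1, h2, h3]

theorem AEMeasurable.dipoleKernel {α : Type*} [MeasurableSpace α] {m : Measure α}
    {f g h : α → Space3} (δ : ℝ) (hf : AEMeasurable f m) (hg : AEMeasurable g m)
    (hh : AEMeasurable h m) : AEMeasurable (fun a => dipoleKernel δ (f a) (g a) (h a)) m := by
  refine ⟨_, hf.measurable_mk.dipoleKernel δ hg.measurable_mk hh.measurable_mk, ?_⟩
  filter_upwards [hf.ae_eq_mk, hg.ae_eq_mk, hh.ae_eq_mk] with a h1 h2 h3
  rw [h1, h2, h3]

theorem abs_dipoleKernel_le {δ : ℝ} (hδ : 0 ≤ δ) {x : Space3} (hx : ‖x‖ = 1) (y : UnitSphere)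
    (v : Space3) : |dipoleKernel δ y x v| ≤ 2 * ‖x - y‖⁻¹ * ‖v‖ := by
  rw [dipoleKernel, ← dipoleForm_apply_of_norm_eq_one hx]
  exact abs_dipoleForm_le hδ hx (norm_coe_unitSphere y) v

theorem tendsto_dipoleKernel {δ : ℕ → ℝ} (hδ : Tendsto δ atTop (𝓝 0)) (y x v : Space3) :
    Tendsto (fun k => dipoleKernel (δ k) y x v) atTop (𝓝 (dipoleKernel 0 y x v)) := by
  rcases eq_or_ne x y with rfl | hxy
  · have : tripleForm x x v = 0 := by simp only [tripleForm_eq]; ring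
    simp [dipoleKernel, this]
  · have hpos : 0 < ‖x - y‖ := norm_pos_iff.2 (sub_ne_zero.2 hxy)
    exact tendsto_const_nhds.div (hδ.const_add _) (by positivity)

theorem dipoleKernel_combination (δ : ℝ) (y x v v' : Space3) (s s' : ℝ) :
    dipoleKernel δ y x (s • v - s' • v') =
      s * dipoleKernel δ y x v - s' * dipoleKernel δ y x v' := by
  simp only [dipoleKernel, map_sub, map_smul, smul_eq_mul]
  ring

theorem integrable_norm_sub_inv {x : Space3} (hx : ‖x‖ = 1) :
    Integrable (fun y : UnitSphere => ‖x - y‖⁻¹) sphereArea := by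
  refine ⟨by fun_prop, ?_⟩
  have hA : 0 < area univ := by
    rw [area, sphereArea_univ, ENNReal.toReal_ofReal (by positivity)]; positivity
  have h := lintegral_norm_sub_inv_le hx univ hA
  rw [Measure.restrict_univ] at h
  rw [hasFiniteIntegral_iff_ofReal (Eventually.of_forall fun y => by positivity)]
  exact h.trans_lt ENNReal.ofReal_lt_top

theorem integrable_dipoleKernel {x : Space3} (hx : ‖x‖ = 1) (v : Space3) :
    Integrable (fun y : UnitSphere => dipoleKernel 0 y x v) sphereArea := by
  have hm : Measurable fun y : UnitSphere => dipoleKernel 0 y x v :=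
    measurable_subtype_coe.dipoleKernel 0 measurable_const measurable_const
  exact (((integrable_norm_sub_inv hx).const_mul 2).mul_const ‖v‖).mono' hm.aestronglyMeasurable
    (Eventually.of_forall fun y => abs_dipoleKernel_le le_rfl hx y v)

theorem abs_setIntegral_dipoleKernel_le {x : Space3} (hx : ‖x‖ = 1) {A : Set UnitSphere}
    (hA : 0 < area A) (v : Space3) :
    |∫ y in A, dipoleKernel 0 y x v ∂sphereArea| ≤
      2 * (2 * Real.pi + 1) * Real.sqrt (area A) * ‖v‖ := by
  have h1 : ∫ y in A, ‖x - (y : Space3)‖⁻¹ ∂sphereArea ≤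
      (2 * Real.pi + 1) * Real.sqrt (area A) := by
    rw [integral_eq_lintegral_of_nonneg_ae (Eventually.of_forall fun y => by positivity)
      (integrable_norm_sub_inv hx).1.restrict]
    exact ENNReal.toReal_le_of_le_ofReal (by positivity) (lintegral_norm_sub_inv_le hx A hA)
  calc |∫ y in A, dipoleKernel 0 y x v ∂sphereArea|
      ≤ ∫ y in A, 2 * ‖x - (y : Space3)‖⁻¹ * ‖v‖ ∂sphereArea := by
        rw [← Real.norm_eq_abs]
        exact norm_integral_le_of_norm_le
          (((integrable_norm_sub_inv hx).restrict.const_mul 2).mul_const ‖v‖)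
          (Eventually.of_forall fun y => abs_dipoleKernel_le le_rfl hx y v)
    _ = 2 * (∫ y in A, ‖x - (y : Space3)‖⁻¹ ∂sphereArea) * ‖v‖ := by
        rw [integral_mul_const, integral_const_mul]
    _ ≤ 2 * ((2 * Real.pi + 1) * Real.sqrt (area A)) * ‖v‖ := by gcongr
    _ = _ := by ring

theorem bubbleKernel_le {δ : ℝ} (hδ : 0 < δ) {t : ℝ} (ht : t ≤ 1) :
    bubbleKernel δ t ≤ (2 + δ) / δ := by
  have h : δ * (2 + δ) / δ ^ 2 = (2 + δ) / δ := by field_simp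
  rw [← h, bubbleKernel]
  gcongr
  linarith

end DipoleKernel

section AreaFormula

open Set Filter Topology
open scoped RealInnerProductSpace BoundedContinuousFunction

variable {n : Plane → Space3} {p : Fin 2 → Plane → Space3}

/-- The vector field `∂₁ζ ∂₂n - ∂₂ζ ∂₁n`. -/
noncomputable def testField (p : Fin 2 → Plane → Space3) (ζ : 𝓓(openDisc, ℝ)) (X : Plane) :
    Space3 :=
  partialDeriv 0 ζ X • p 1 X - partialDeriv 1 ζ X • p 0 X

theorem continuous_partialDeriv (ζ : 𝓓(openDisc, ℝ)) (i : Fin 2) :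
    Continuous (partialDeriv i ζ) :=
  ((ζ.contDiff.fderiv_right (m := 0) (by simp)).clm_apply contDiff_const).continuous

theorem hasCompactSupport_partialDeriv (ζ : 𝓓(openDisc, ℝ)) (i : Fin 2) :
    HasCompactSupport (partialDeriv i ζ) :=
  ζ.hasCompactSupport.fderiv_apply ℝ _

theorem areaDensity_eq (n : Plane → Space3) (p : Fin 2 → Plane → Space3) (X : Plane) :
    areaDensity n p X = tripleForm (n X) (p 0 X) (p 1 X) := rfl

namespace IsW12SphereMap

theorem integrable_deriv (h : IsW12SphereMap n p) (i : Fin 2) : Integrable (p i) discMeasure :=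
  (h.memLp_deriv i).integrable one_le_two

theorem aemeasurable (h : IsW12SphereMap n p) : AEMeasurable n discMeasure := h.memLp.1.aemeasurable

theorem aemeasurable_deriv (h : IsW12SphereMap n p) (i : Fin 2) : AEMeasurable (p i) discMeasure :=
  (h.memLp_deriv i).1.aemeasurable

theorem integrable_areaDensity (h : IsW12SphereMap n p) :
    Integrable (areaDensity n p) discMeasure := by
  refine ((h.memLp_deriv 0).norm.integrable_mul (h.memLp_deriv 1).norm).mono'
    (h.aemeasurable.tripleForm (h.aemeasurable_deriv 0)
      (h.aemeasurable_deriv 1)).aestronglyMeasurable ?_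
  filter_upwards [h.norm_eq_one] with X hX
  have := abs_tripleForm_le (n X) (p 0 X) (p 1 X)
  rwa [hX, one_mul] at this

theorem integrable_testFunction_mul_areaDensity (h : IsW12SphereMap n p) (ζ : 𝓓(openDisc, ℝ)) :
    Integrable (fun X => ζ X * areaDensity n p X) discMeasure := by
  obtain ⟨M, hM⟩ := ζ.continuous.bounded_above_of_compact_support ζ.hasCompactSupport
  exact h.integrable_areaDensity.bdd_mul ζ.continuous.aestronglyMeasurable
    (Eventually.of_forall hM)

theorem integrable_testField (h : IsW12SphereMap n p) (ζ : 𝓓(openDisc, ℝ)) :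
    Integrable (testField p ζ) discMeasure := by
  have key : ∀ i j, Integrable (fun X => partialDeriv i ζ X • p j X) discMeasure := by
    intro i j
    obtain ⟨M, hM⟩ := (continuous_partialDeriv ζ i).bounded_above_of_compact_support
      (hasCompactSupport_partialDeriv ζ i)
    exact (h.integrable_deriv j).bdd_smul M
      (continuous_partialDeriv ζ i).aestronglyMeasurable (Eventually.of_forall hM)
  exact (key 0 1).sub (key 1 0)

/-- The identity for a single regularised dipole potential. -/
theorem integral_dipoleKernel (h : IsW12SphereMap n p) (ζ : 𝓓(openDisc, ℝ)) {δ : ℝ} (hδ : 0 < δ)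
    (y : UnitSphere) :
    ∫ X, dipoleKernel δ y (n X) (testField p ζ X) ∂discMeasure =
      - ∫ X, ζ X * areaDensity n p X * (bubbleKernel δ ⟪n X, (y : Space3)⟫ - 1) ∂discMeasure := by
  have hS := h.integral_oneForm_comp (contDiff_dipoleForm hδ y) ζ
  rw [integral_congr_ae (g := fun X => partialDeriv 0 ζ X * dipoleForm δ y (n X) (p 1 X)
    - partialDeriv 1 ζ X * dipoleForm δ y (n X) (p 0 X)), hS]
  · congr 1
    refine integral_congr_ae ?_
    filter_upwards [h.norm_eq_one] with X hX
    rw [fderiv_dipoleForm_sub hδ hX (norm_coe_unitSphere y), areaDensity_eq]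
    ring
  · filter_upwards [h.norm_eq_one] with X hX
    rw [testField, dipoleKernel_combination, dipoleForm_apply_of_norm_eq_one hX,
      dipoleForm_apply_of_norm_eq_one hX]
    rfl

theorem ae_prod_norm_eq_one (h : IsW12SphereMap n p) :
    ∀ᵐ q ∂(discMeasure.prod sphereArea), ‖n q.1‖ = 1 :=
  Measure.quasiMeasurePreserving_fst.ae h.norm_eq_one

theorem aemeasurable_dipoleKernel_prod (h : IsW12SphereMap n p) (ζ : 𝓓(openDisc, ℝ)) (δ : ℝ) :
    AEMeasurable (fun q : Plane × UnitSphere => dipoleKernel δ q.2 (n q.1) (testField p ζ q.1))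
      (discMeasure.prod sphereArea) :=
  AEMeasurable.dipoleKernel δ (measurable_subtype_coe.comp measurable_snd).aemeasurable
    h.aemeasurable.comp_fst (h.integrable_testField ζ).1.aemeasurable.comp_fst

theorem integrable_norm_sub_inv_mul_norm (h : IsW12SphereMap n p) (ζ : 𝓓(openDisc, ℝ)) :
    Integrable (fun q : Plane × UnitSphere => 2 * ‖n q.1 - q.2‖⁻¹ * ‖testField p ζ q.1‖)
      (discMeasure.prod sphereArea) := by
  have hw := h.integrable_testField ζ
  have hm : AEMeasurable (fun q : Plane × UnitSphere => ‖n q.1 - q.2‖⁻¹)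
      (discMeasure.prod sphereArea) :=
    (h.aemeasurable.comp_fst.sub
      (measurable_subtype_coe.comp measurable_snd).aemeasurable).norm.inv
  have hwm : AEMeasurable (fun q : Plane × UnitSphere => ‖testField p ζ q.1‖)
      (discMeasure.prod sphereArea) := hw.1.aemeasurable.norm.comp_fst
  have hA : 0 < area univ := by
    rw [area, sphereArea_univ, ENNReal.toReal_ofReal (by positivity)]; positivity
  have hp : AEMeasurable (fun q : Plane × UnitSphere =>
      ‖n q.1 - q.2‖⁻¹ * ‖testField p ζ q.1‖) (discMeasure.prod sphereArea) := hm.mul hwm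
  simp_rw [mul_assoc]
  refine Integrable.const_mul ⟨hp.aestronglyMeasurable, ?_⟩ 2
  rw [hasFiniteIntegral_iff_ofReal (Eventually.of_forall fun q =>
    mul_nonneg (inv_nonneg.2 (norm_nonneg _)) (norm_nonneg _))]
  rw [lintegral_prod _ hp.ennreal_ofReal]
  set C := ENNReal.ofReal ((2 * Real.pi + 1) * Real.sqrt (area univ))
  have hle : ∫⁻ X, ∫⁻ y, ENNReal.ofReal (‖n X - (y : Space3)‖⁻¹ * ‖testField p ζ X‖) ∂sphereArea
      ∂discMeasure ≤ ∫⁻ X, C * ENNReal.ofReal ‖testField p ζ X‖ ∂discMeasure := by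
    refine lintegral_mono_ae ?_
    filter_upwards [h.norm_eq_one] with X hX
    have hl := lintegral_norm_sub_inv_le hX univ hA
    rw [Measure.restrict_univ] at hl
    simp_rw [ENNReal.ofReal_mul (inv_nonneg.2 (norm_nonneg _))]
    rw [lintegral_mul_const' _ _ ENNReal.ofReal_ne_top]
    gcongr
  refine hle.trans_lt ?_
  rw [lintegral_const_mul' _ _ ENNReal.ofReal_ne_top]
  refine ENNReal.mul_lt_top ENNReal.ofReal_lt_top ?_
  simp_rw [ofReal_norm]
  exact hw.2

theorem integrable_dipoleKernel_prod (h : IsW12SphereMap n p) (ζ : 𝓓(openDisc, ℝ))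
    {δ : ℝ} (hδ : 0 ≤ δ) :
    Integrable (fun q : Plane × UnitSphere => dipoleKernel δ q.2 (n q.1) (testField p ζ q.1))
      (discMeasure.prod sphereArea) := by
  refine (h.integrable_norm_sub_inv_mul_norm ζ).mono'
    (h.aemeasurable_dipoleKernel_prod ζ δ).aestronglyMeasurable ?_
  filter_upwards [h.ae_prod_norm_eq_one] with q hq
  exact abs_dipoleKernel_le hδ hq q.2 _

theorem integrable_bubbleKernel_prod (h : IsW12SphereMap n p) (ζ : 𝓓(openDisc, ℝ))
    {δ : ℝ} (hδ : 0 < δ) :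
    Integrable (fun q : Plane × UnitSphere => ζ q.1 * areaDensity n p q.1 *
      (bubbleKernel δ ⟪n q.1, (q.2 : Space3)⟫ - 1)) (discMeasure.prod sphereArea) := by
  have hζ : Integrable (fun q : Plane × UnitSphere => ζ q.1 * areaDensity n p q.1)
      (discMeasure.prod sphereArea) :=
    (h.integrable_testFunction_mul_areaDensity ζ).comp_fst sphereArea
  have hi : AEMeasurable (fun q : Plane × UnitSphere => ⟪n q.1, (q.2 : Space3)⟫)
      (discMeasure.prod sphereArea) :=
    h.aemeasurable.comp_fst.inner (measurable_subtype_coe.comp measurable_snd).aemeasurable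
  refine hζ.mul_bdd (c := (2 + δ) / δ + 1)
    (((measurable_bubbleKernel δ).comp_aemeasurable hi).sub_const 1).aestronglyMeasurable ?_
  filter_upwards [h.ae_prod_norm_eq_one] with q hq
  have h0 := bubbleKernel_nonneg hδ.le ⟪n q.1, (q.2 : Space3)⟫
  have h1 := bubbleKernel_le hδ (inner_le_one_unitSphere hq q.2)
  rw [Real.norm_eq_abs, abs_le]
  constructor <;> linarith

/-- The identity for the potentials of continuous densities on the sphere. -/
theorem integral_prod_dipoleKernel (h : IsW12SphereMap n p) (ζ : 𝓓(openDisc, ℝ)) (f : Space3 →ᵇ ℝ) :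
    ∫ q : Plane × UnitSphere, f q.2 * dipoleKernel 0 q.2 (n q.1) (testField p ζ q.1)
        ∂(discMeasure.prod sphereArea) =
      - ∫ X, ζ X * areaDensity n p X * (4 * Real.pi * f (n X) - ∫ y, f (y : Space3) ∂sphereArea)
        ∂discMeasure := by
  set δ : ℕ → ℝ := fun k => 1 / ((k : ℝ) + 1) with hδdef
  have hδ0 : ∀ k, 0 < δ k := fun k => by positivity
  have hδ : Tendsto δ atTop (𝓝 0) := tendsto_one_div_add_atTop_nhds_zero_nat
  have hδ' : Tendsto δ atTop (𝓝[>] 0) :=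
    tendsto_nhdsWithin_iff.2 ⟨hδ, Eventually.of_forall hδ0⟩
  have hfm : Measurable fun q : Plane × UnitSphere => f q.2 :=
    f.continuous.measurable.comp (measurable_subtype_coe.comp measurable_snd)
  have hfb : ∀ e, ‖f e‖ ≤ ‖f‖ := f.norm_coe_le_norm
  have hfi : Integrable (fun y : UnitSphere => f y) sphereArea :=
    (f.compContinuous ⟨_, continuous_subtype_val⟩).integrable sphereArea
  have L1 : Tendsto (fun k => ∫ q : Plane × UnitSphere, f q.2 *
      dipoleKernel (δ k) q.2 (n q.1) (testField p ζ q.1) ∂(discMeasure.prod sphereArea)) atTop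
      (𝓝 (∫ q : Plane × UnitSphere, f q.2 * dipoleKernel 0 q.2 (n q.1) (testField p ζ q.1)
        ∂(discMeasure.prod sphereArea))) := by
    refine tendsto_integral_of_dominated_convergence
      (fun q => ‖f‖ * (2 * ‖n q.1 - (q.2 : Space3)‖⁻¹ * ‖testField p ζ q.1‖))
      (fun k => (hfm.aemeasurable.mul
        (h.aemeasurable_dipoleKernel_prod ζ (δ k))).aestronglyMeasurable)
      ((h.integrable_norm_sub_inv_mul_norm ζ).const_mul _) (fun k => ?_)
      (Eventually.of_forall fun q => (tendsto_dipoleKernel hδ _ _ _).const_mul _)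
    filter_upwards [h.ae_prod_norm_eq_one] with q hq
    rw [norm_mul]
    exact mul_le_mul (hfb _) (abs_dipoleKernel_le (hδ0 k).le hq q.2 _) (norm_nonneg _)
      (norm_nonneg _)
  have heq : ∀ k, ∫ q : Plane × UnitSphere, f q.2 *
      dipoleKernel (δ k) q.2 (n q.1) (testField p ζ q.1) ∂(discMeasure.prod sphereArea) =
      - ∫ X, ζ X * areaDensity n p X * (∫ y, bubbleKernel (δ k) ⟪n X, (y : Space3)⟫ * f y
        ∂sphereArea - ∫ y, f (y : Space3) ∂sphereArea) ∂discMeasure := by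
    intro k
    have hb : ∀ᵐ q ∂(discMeasure.prod sphereArea), ‖f (q.2 : Space3)‖ ≤ ‖f‖ :=
      Eventually.of_forall fun q => hfb _
    have i1 : Integrable (fun q : Plane × UnitSphere => f q.2 *
        dipoleKernel (δ k) q.2 (n q.1) (testField p ζ q.1)) (discMeasure.prod sphereArea) :=
      (h.integrable_dipoleKernel_prod ζ (hδ0 k).le).bdd_mul hfm.aestronglyMeasurable hb
    have i2 : Integrable (fun q : Plane × UnitSphere => f q.2 * (ζ q.1 * areaDensity n p q.1 *
        (bubbleKernel (δ k) ⟪n q.1, (q.2 : Space3)⟫ - 1))) (discMeasure.prod sphereArea) :=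
      (h.integrable_bubbleKernel_prod ζ (hδ0 k)).bdd_mul hfm.aestronglyMeasurable hb
    rw [integral_prod_symm _ i1]
    simp only [integral_const_mul]
    simp_rw [h.integral_dipoleKernel ζ (hδ0 k), mul_neg, integral_neg, ← integral_const_mul]
    rw [← integral_prod_symm (fun q : Plane × UnitSphere => f q.2 * (ζ q.1 * areaDensity n p q.1 *
        (bubbleKernel (δ k) ⟪n q.1, (q.2 : Space3)⟫ - 1))) i2, integral_prod _ i2]
    congr 1
    refine integral_congr_ae ?_
    filter_upwards [h.norm_eq_one] with X hX
    have hbi : Integrable (fun y : UnitSphere =>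
        bubbleKernel (δ k) ⟪n X, (y : Space3)⟫ * f y) sphereArea :=
      (integrable_bubbleKernel (hδ0 k) hX).mul_bdd hfi.1 (Eventually.of_forall fun y => hfb y)
    rw [← integral_sub hbi hfi, ← integral_const_mul]
    refine integral_congr_ae (Eventually.of_forall fun y => ?_)
    ring
  have L2 : Tendsto (fun k => - ∫ X, ζ X * areaDensity n p X *
      (∫ y, bubbleKernel (δ k) ⟪n X, (y : Space3)⟫ * f y
        ∂sphereArea - ∫ y, f (y : Space3) ∂sphereArea) ∂discMeasure) atTop
      (𝓝 (- ∫ X, ζ X * areaDensity n p X * (4 * Real.pi * f (n X)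
        - ∫ y, f (y : Space3) ∂sphereArea) ∂discMeasure)) := by
    refine (tendsto_integral_of_dominated_convergence
      (fun X => ‖ζ X * areaDensity n p X‖ * (4 * Real.pi * ‖f‖
        + ‖∫ y, f (y : Space3) ∂sphereArea‖)) (fun k => ?_)
      ((h.integrable_testFunction_mul_areaDensity ζ).norm.mul_const _) (fun k => ?_) ?_).neg
    · have hi : AEMeasurable (fun q : Plane × UnitSphere => ⟪n q.1, (q.2 : Space3)⟫)
          (discMeasure.prod sphereArea) :=
        h.aemeasurable.comp_fst.inner (measurable_subtype_coe.comp measurable_snd).aemeasurable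
      have hm : AEStronglyMeasurable (fun q : Plane × UnitSphere =>
          bubbleKernel (δ k) ⟪n q.1, (q.2 : Space3)⟫ * f q.2) (discMeasure.prod sphereArea) :=
        (((measurable_bubbleKernel (δ k)).comp_aemeasurable hi).mul
          hfm.aemeasurable).aestronglyMeasurable
      exact (h.integrable_testFunction_mul_areaDensity ζ).1.mul
        (hm.integral_prod_right'.sub aestronglyMeasurable_const)
    · filter_upwards [h.norm_eq_one] with X hX
      rw [norm_mul]
      refine mul_le_mul_of_nonneg_left ((norm_sub_le _ _).trans (add_le_add_left ?_ _))
        (norm_nonneg _)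
      rw [← integral_bubbleKernel (hδ0 k) hX, ← integral_mul_const]
      refine norm_integral_le_of_norm_le ((integrable_bubbleKernel (hδ0 k) hX).mul_const _)
        (Eventually.of_forall fun y => ?_)
      rw [norm_mul, Real.norm_of_nonneg (bubbleKernel_nonneg (hδ0 k).le _)]
      exact mul_le_mul_of_nonneg_left (hfb _) (bubbleKernel_nonneg (hδ0 k).le _)
    · filter_upwards [h.norm_eq_one] with X hX
      exact (((tendsto_integral_bubbleKernel hX f).comp hδ').sub_const _).const_mul _
  simp_rw [heq] at L1
  exact tendsto_nhds_unique L1 L2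

end IsW12SphereMap

end AreaFormula

section AreaIdentity

open Set Filter Topology
open scoped RealInnerProductSpace BoundedContinuousFunction

variable {n : Plane → Space3} {p : Fin 2 → Plane → Space3}

theorem measurableSet_coe_image {A : Set UnitSphere} (hA : MeasurableSet A) :
    MeasurableSet (((↑) : UnitSphere → Space3) '' A) :=
  (MeasurableEmbedding.subtype_coe Metric.isClosed_sphere.measurableSet).measurableSet_image.2 hA

theorem discPreimage_eq (n : Plane → Space3) (A : Set UnitSphere) :
    discPreimage n A = n ⁻¹' (((↑) : UnitSphere → Space3) '' A) ∩ closedDisc := by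
  ext X; simp [discPreimage, and_comm]

theorem nullMeasurableSet_preimage_coe_image (h : IsW12SphereMap n p) {A : Set UnitSphere}
    (hA : MeasurableSet A) :
    NullMeasurableSet (n ⁻¹' (((↑) : UnitSphere → Space3) '' A)) discMeasure :=
  h.aemeasurable.nullMeasurable (measurableSet_coe_image hA)

theorem restrict_discPreimage (h : IsW12SphereMap n p) {A : Set UnitSphere}
    (hA : MeasurableSet A) : volume.restrict (discPreimage n A) =
      discMeasure.restrict (n ⁻¹' (((↑) : UnitSphere → Space3) '' A)) := by
  rw [discMeasure, Measure.restrict_restrict₀ (nullMeasurableSet_preimage_coe_image h hA),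
    discPreimage_eq]

/-- The identity for the potentials of indicator functions on the sphere. -/
theorem IsW12SphereMap.integral_setIntegral_dipoleKernel (h : IsW12SphereMap n p)
    (ζ : 𝓓(openDisc, ℝ)) {A : Set UnitSphere} (hA : MeasurableSet A) :
    ∫ X, (∫ y in A, dipoleKernel 0 y (n X) (testField p ζ X) ∂sphereArea) ∂discMeasure =
      area A * ∫ X, areaDensity n p X * ζ X ∂discMeasure
        - 4 * Real.pi * ∫ X in discPreimage n A, areaDensity n p X * ζ X := by
  set A' := ((↑) : UnitSphere → Space3) '' A with hA'
  have hA'm : MeasurableSet A' := measurableSet_coe_image hA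
  set g : Plane → ℝ := fun X => ζ X * areaDensity n p X with hg
  have hgi : Integrable g discMeasure := h.integrable_testFunction_mul_areaDensity ζ
  have hK := h.integrable_dipoleKernel_prod ζ le_rfl
  have hΨ : Integrable (fun q : Plane × UnitSphere =>
      dipoleKernel 0 q.2 (n q.1) (testField p ζ q.1) - g q.1) (discMeasure.prod sphereArea) :=
    hK.sub (hgi.comp_fst sphereArea)
  have hcoe : AEMeasurable (fun q : Plane × UnitSphere => (q.2 : Space3))
      (discMeasure.prod sphereArea) := (measurable_subtype_coe.comp measurable_snd).aemeasurable
  have key := integral_indicator_comp_eq_of_forall_boundedContinuous hcoe hΨ h.aemeasurable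
    (hgi.const_mul (-(4 * Real.pi))) (fun f => by
      have hfb : ∀ e, ‖f e‖ ≤ ‖f‖ := f.norm_coe_le_norm
      have hfm : AEStronglyMeasurable (fun q : Plane × UnitSphere => f q.2)
          (discMeasure.prod sphereArea) :=
        (f.continuous.measurable.comp
          (measurable_subtype_coe.comp measurable_snd)).aestronglyMeasurable
      have i1 := hK.bdd_mul hfm (Eventually.of_forall fun q => hfb q.2)
      have i2 := (hgi.comp_fst sphereArea).bdd_mul hfm (Eventually.of_forall fun q => hfb q.2)
      have i3 : Integrable (fun X => g X * (4 * Real.pi * f (n X))) discMeasure :=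
        hgi.mul_bdd (c := 4 * Real.pi * ‖f‖)
          ((f.continuous.measurable.comp_aemeasurable
            h.aemeasurable).const_mul _).aestronglyMeasurable
          (Eventually.of_forall fun X => by
            rw [norm_mul, Real.norm_of_nonneg (by positivity)]
            exact mul_le_mul_of_nonneg_left (hfb _) (by positivity))
      have e1 := h.integral_prod_dipoleKernel ζ f
      have e2 : ∫ q : Plane × UnitSphere, f q.2 * g q.1 ∂(discMeasure.prod sphereArea) =
          ∫ X, g X * ∫ y, f (y : Space3) ∂sphereArea ∂discMeasure := by
        rw [integral_prod _ i2]
        refine integral_congr_ae (Eventually.of_forall fun X => ?_)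
        simp only [integral_mul_const]
        rw [mul_comm]
      simp_rw [mul_sub]
      rw [integral_sub i1 i2, e1, e2]
      simp only [mul_sub]
      rw [integral_sub i3 (hgi.mul_const _), neg_sub, sub_sub_cancel_left, ← integral_neg]
      refine integral_congr_ae (Eventually.of_forall fun X => ?_)
      simp only
      ring) hA'm
  have hmem : ∀ y : UnitSphere, A'.indicator (1 : Space3 → ℝ) y = A.indicator 1 y := by
    intro y
    have : (y : Space3) ∈ A' ↔ y ∈ A := Subtype.val_injective.mem_set_image
    by_cases hy : y ∈ A
    · simp [hy, this.2 hy]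
    · simp [hy, this.not.2 hy]
  have hind : Integrable (fun q : Plane × UnitSphere => A'.indicator (1 : Space3 → ℝ) q.2 *
      (dipoleKernel 0 q.2 (n q.1) (testField p ζ q.1) - g q.1)) (discMeasure.prod sphereArea) := by
    refine hΨ.bdd_mul (c := 1) ((measurable_one.indicator hA'm).comp
      (measurable_subtype_coe.comp measurable_snd)).aestronglyMeasurable
      (Eventually.of_forall fun q => ?_)
    by_cases hq : (q.2 : Space3) ∈ A' <;> simp [hq]
  rw [integral_prod _ hind] at key
  have hleft : ∫ X, ∫ y : UnitSphere, A'.indicator (1 : Space3 → ℝ) y *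
      (dipoleKernel 0 y (n X) (testField p ζ X) - g X) ∂sphereArea ∂discMeasure =
      ∫ X, ((∫ y in A, dipoleKernel 0 y (n X) (testField p ζ X) ∂sphereArea) - area A * g X)
        ∂discMeasure := by
    refine integral_congr_ae ?_
    filter_upwards [h.norm_eq_one] with X hX
    have hk := (integrable_dipoleKernel hX (testField p ζ X)).restrict (s := A)
    have hind2 : ∀ y : UnitSphere, A'.indicator (1 : Space3 → ℝ) y *
        (dipoleKernel 0 y (n X) (testField p ζ X) - g X) = A.indicator (fun y : UnitSphere =>
          dipoleKernel 0 y (n X) (testField p ζ X) - g X) y := by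
      intro y
      rw [hmem]
      by_cases hy : y ∈ A <;> simp [hy]
    simp_rw [hind2]
    rw [integral_indicator hA, integral_sub hk (integrable_const _), setIntegral_const]
    rfl
  have hkA : Integrable (fun X => ∫ y in A, dipoleKernel 0 y (n X) (testField p ζ X) ∂sphereArea)
      discMeasure := by
    have h1 := (hK.mono_measure (Measure.prod_mono le_rfl
      (Measure.restrict_le_self (μ := sphereArea) (s := A))))
    exact h1.integral_prod_left
  have hright : ∫ X, A'.indicator (1 : Space3 → ℝ) (n X) * (-(4 * Real.pi) * g X) ∂discMeasure =
      -(4 * Real.pi) * ∫ X in discPreimage n A, areaDensity n p X * ζ X := by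
    rw [restrict_discPreimage h hA, ← integral_indicator₀
      (nullMeasurableSet_preimage_coe_image h hA), ← integral_const_mul]
    refine integral_congr_ae (Eventually.of_forall fun X => ?_)
    by_cases hX : n X ∈ A'
    · have hX' : X ∈ n ⁻¹' (Subtype.val '' A) := hX
      simp only [indicator_of_mem hX, indicator_of_mem hX', Pi.one_apply, hg]
      ring
    · have hX' : X ∉ n ⁻¹' (Subtype.val '' A) := hX
      simp only [indicator_of_notMem hX, indicator_of_notMem hX']
      ring
  rw [hleft, hright, integral_sub hkA (hgi.const_mul _), integral_const_mul] at key
  simp only [mul_comm (areaDensity n p _)] at key ⊢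
  linarith

/-- The components `Ω₁`, `Ω₂` of the potential. -/
noncomputable def dipolePotential (n : Plane → Space3) (A : Set UnitSphere) (v : Plane → Space3)
    (X : Plane) : ℝ :=
  (area A)⁻¹ * ∫ y in A, dipoleKernel 0 y (n X) (v X) ∂sphereArea

theorem IsW12SphereMap.aestronglyMeasurable_dipolePotential (h : IsW12SphereMap n p)
    (A : Set UnitSphere) (i : Fin 2) :
    AEStronglyMeasurable (dipolePotential n A (p i)) discMeasure := by
  have hm : AEMeasurable (fun q : Plane × UnitSphere => dipoleKernel 0 q.2 (n q.1) (p i q.1))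
      (discMeasure.prod (sphereArea.restrict A)) :=
    AEMeasurable.dipoleKernel 0 (measurable_subtype_coe.comp measurable_snd).aemeasurable
      h.aemeasurable.comp_fst (h.aemeasurable_deriv i).comp_fst
  exact hm.aestronglyMeasurable.integral_prod_right'.const_mul _

theorem abs_dipolePotential_le {X : Plane} (hX : ‖n X‖ = 1) {A : Set UnitSphere}
    (hA : 0 < area A) (v : Plane → Space3) :
    |dipolePotential n A v X| ≤
      2 * (2 * Real.pi + 1) * (area A) ^ (-(1 / 2) : ℝ) * ‖v X‖ := by
  have h := abs_setIntegral_dipoleKernel_le hX hA (v X)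
  have hr : (area A)⁻¹ * Real.sqrt (area A) = (area A) ^ (-(1 / 2) : ℝ) := by
    rw [Real.sqrt_eq_rpow, ← Real.rpow_neg_one, ← Real.rpow_add hA]
    norm_num
  rw [dipolePotential, abs_mul, abs_of_pos (inv_pos.2 hA), ← hr]
  calc _ ≤ (area A)⁻¹ * (2 * (2 * Real.pi + 1) * Real.sqrt (area A) * ‖v X‖) := by gcongr
    _ = _ := by ring

theorem dipolePotential_combination {X : Plane} (hX : ‖n X‖ = 1) (A : Set UnitSphere)
    (ζ : 𝓓(openDisc, ℝ)) :
    dipolePotential n A (p 1) X * partialDeriv 0 ζ X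
      - dipolePotential n A (p 0) X * partialDeriv 1 ζ X =
      (area A)⁻¹ * ∫ y in A, dipoleKernel 0 y (n X) (testField p ζ X) ∂sphereArea := by
  simp_rw [testField, dipoleKernel_combination]
  rw [integral_sub ((integrable_dipoleKernel hX _).restrict.const_mul _)
    ((integrable_dipoleKernel hX _).restrict.const_mul _), integral_const_mul, integral_const_mul]
  simp only [dipolePotential]
  ring

theorem gradLength_sq {E : Type*} [NormedAddCommGroup E] (p : Fin 2 → Plane → E) (X : Plane) :
    gradLength p X ^ 2 = ‖p 0 X‖ ^ 2 + ‖p 1 X‖ ^ 2 := by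
  rw [gradLength, Real.sq_sqrt (by positivity), Fin.sum_univ_two]

theorem gradLength_nonneg {E : Type*} [NormedAddCommGroup E] (p : Fin 2 → Plane → E) (X : Plane) :
    0 ≤ gradLength p X := Real.sqrt_nonneg _

theorem norm_le_gradLength {E : Type*} [NormedAddCommGroup E] (p : Fin 2 → Plane → E) (X : Plane)
    (i : Fin 2) : ‖p i X‖ ≤ gradLength p X :=
  Real.le_sqrt_of_sq_le (Finset.single_le_sum (f := fun i => ‖p i X‖ ^ 2)
    (fun _ _ => by positivity) (Finset.mem_univ i))

theorem memLp_gradLength {E : Type*} [NormedAddCommGroup E] {p : Fin 2 → Plane → E}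
    (hp : ∀ i, MemLp (p i) 2 discMeasure) : MemLp (gradLength p) 2 discMeasure := by
  refine ((hp 0).norm.add (hp 1).norm).mono' ?_ (Eventually.of_forall fun X => ?_)
  · refine Real.continuous_sqrt.comp_aestronglyMeasurable ?_
    exact (((hp 0).1.norm.pow 2).add ((hp 1).1.norm.pow 2)).congr
      (Eventually.of_forall fun X => by simp [Fin.sum_univ_two])
  · rw [Real.norm_of_nonneg (gradLength_nonneg p X)]
    refine abs_le_of_sq_le_sq' ?_ (add_nonneg (norm_nonneg (p 0 X)) (norm_nonneg (p 1 X))) |>.2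
    rw [gradLength_sq]
    nlinarith [norm_nonneg (p 0 X), norm_nonneg (p 1 X)]

theorem l2Norm_le_of_abs_le {u v : Plane → ℝ} (hv : MemLp v 2 discMeasure) {C : ℝ} (hC : 0 ≤ C)
    (huv : ∀ᵐ X ∂discMeasure, |u X| ≤ C * |v X|) : l2Norm u ≤ C * l2Norm v := by
  have h := eLpNorm_le_mul_eLpNorm_of_ae_le_mul (f := u) (g := v)
    (μ := discMeasure) (c := C) huv 2
  have h2 := ENNReal.toReal_mono (ENNReal.mul_ne_top ENNReal.ofReal_ne_top hv.2.ne) h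
  rwa [ENNReal.toReal_mul, ENNReal.toReal_ofReal hC] at h2

theorem integral_mul_le_l2Norm {u v : Plane → ℝ} (hu : MemLp u 2 discMeasure)
    (hv : MemLp v 2 discMeasure) : ∫ X, u X * v X ∂discMeasure ≤ l2Norm u * l2Norm v := by
  have h := abs_integral_clm_apply₂_le (ν := discMeasure)
    (b := fun _ => ContinuousLinearMap.mul ℝ ℝ) (C := 1)
    (Eventually.of_forall fun _ => ContinuousLinearMap.opNorm_mul_le ℝ ℝ) hu hv
  rw [NNReal.coe_one, one_mul] at h
  exact (le_abs_self _).trans h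

end AreaIdentity

theorem mainTheorem3 :
    ∃ c : ℝ, 0 < c ∧
      ∀ (n : Plane → Space3) (p : Fin 2 → Plane → Space3), IsW12SphereMap n p →
      ∀ A : Set UnitSphere, MeasurableSet A → 0 < area A →
        (∃ Ω₁ Ω₂ : Plane → ℝ,
          MemLp Ω₁ 2 discMeasure ∧ MemLp Ω₂ 2 discMeasure ∧
          l2Norm Ω₁ ≤ c * (area A) ^ (-(1 / 2) : ℝ) * l2Norm (gradLength p) ∧
          l2Norm Ω₂ ≤ c * (area A) ^ (-(1 / 2) : ℝ) * l2Norm (gradLength p) ∧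
          ∀ ζ : 𝓓(openDisc, ℝ),
            (∫ X in closedDisc, areaDensity n p X * ζ X) =
              4 * Real.pi / area A * (∫ X in discPreimage n A, areaDensity n p X * ζ X)
              + (∫ X in closedDisc,
                  (Ω₂ X * partialDeriv 0 ζ X - Ω₁ X * partialDeriv 1 ζ X))) ∧
        negSobolevNorm (fun X => areaDensity n p X
            - 4 * Real.pi / area A * (discPreimage n A).indicator (areaDensity n p) X)
          ≤ ENNReal.ofReal (c * (area A) ^ (-(1 / 2) : ℝ) * l2Norm (gradLength p)) := by
  refine ⟨2 * (2 * Real.pi + 1), by positivity, fun n p h A hAm hA => ?_⟩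
  set C : ℝ := 2 * (2 * Real.pi + 1) * (area A) ^ (-(1 / 2) : ℝ) with hC
  have hC0 : 0 ≤ C := by positivity
  set Ω : Fin 2 → Plane → ℝ := fun i => dipolePotential n A (p i) with hΩ
  have hgrad : MemLp (gradLength p) 2 discMeasure := memLp_gradLength h.memLp_deriv
  have hΩle : ∀ᵐ X ∂discMeasure, ∀ i, |Ω i X| ≤ C * ‖p i X‖ := by
    filter_upwards [h.norm_eq_one] with X hX i
    exact abs_dipolePotential_le hX hA (p i)
  have hΩm : ∀ i, MemLp (Ω i) 2 discMeasure := fun i =>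
    (h.memLp_deriv i).of_le_mul (h.aestronglyMeasurable_dipolePotential A i)
      (hΩle.mono fun X hX => hX i)
  have hΩn : ∀ i, l2Norm (Ω i) ≤ C * l2Norm (gradLength p) := fun i =>
    l2Norm_le_of_abs_le hgrad hC0 (hΩle.mono fun X hX => (hX i).trans
      (mul_le_mul_of_nonneg_left ((norm_le_gradLength p X i).trans (le_abs_self _)) hC0))
  have hid : ∀ ζ : 𝓓(openDisc, ℝ), (∫ X in closedDisc, areaDensity n p X * ζ X) =
      4 * Real.pi / area A * (∫ X in discPreimage n A, areaDensity n p X * ζ X)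
      + (∫ X in closedDisc, (Ω 1 X * partialDeriv 0 ζ X - Ω 0 X * partialDeriv 1 ζ X)) := by
    intro ζ
    have h1 : ∫ X in closedDisc, (Ω 1 X * partialDeriv 0 ζ X - Ω 0 X * partialDeriv 1 ζ X) =
        (area A)⁻¹ * ∫ X, (∫ y in A, dipoleKernel 0 y (n X) (testField p ζ X) ∂sphereArea)
          ∂discMeasure := by
      rw [← MeasureTheory.integral_const_mul]
      refine integral_congr_ae ?_
      filter_upwards [h.norm_eq_one] with X hX
      exact dipolePotential_combination hX A ζ
    rw [h1, h.integral_setIntegral_dipoleKernel ζ hAm, discMeasure]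
    field_simp
    ring
  refine ⟨⟨Ω 0, Ω 1, hΩm 0, hΩm 1, hΩn 0, hΩn 1, hid⟩, ?_⟩
  refine iSup₂_le fun ζ hζ => ENNReal.ofReal_le_ofReal ?_
  have hζm : ∀ i, MemLp (partialDeriv i ζ) 2 discMeasure := fun i =>
    ((continuous_partialDeriv ζ i).memLp_of_hasCompactSupport
      (hasCompactSupport_partialDeriv ζ i))
  have hζg := memLp_gradLength hζm
  have hΦζ : MeasureTheory.Integrable (fun X => areaDensity n p X * ζ X) discMeasure := by
    simpa only [mul_comm] using h.integrable_testFunction_mul_areaDensity ζ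
  have heq : ∫ X, (areaDensity n p X
      - 4 * Real.pi / area A * (discPreimage n A).indicator (areaDensity n p) X) * ζ X
      ∂discMeasure =
      ∫ X in closedDisc, (Ω 1 X * partialDeriv 0 ζ X - Ω 0 X * partialDeriv 1 ζ X) := by
    set N := n ⁻¹' (((↑) : UnitSphere → Space3) '' A) with hN
    have hNm : NullMeasurableSet N discMeasure := nullMeasurableSet_preimage_coe_image h hAm
    have h2 : ∫ X, (areaDensity n p X
        - 4 * Real.pi / area A * (discPreimage n A).indicator (areaDensity n p) X) * ζ X
        ∂discMeasure = ∫ X, (areaDensity n p X * ζ X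
        - 4 * Real.pi / area A * N.indicator (fun X => areaDensity n p X * ζ X) X)
        ∂discMeasure := by
      refine setIntegral_congr_fun measurableSet_closedDisc fun X hX => ?_
      by_cases hXN : X ∈ N
      · have hX' : X ∈ discPreimage n A := by rw [discPreimage_eq]; exact ⟨hXN, hX⟩
        simp only [Set.indicator_of_mem hXN, Set.indicator_of_mem hX']
        ring
      · have hX' : X ∉ discPreimage n A := by rw [discPreimage_eq]; exact fun hx => hXN hx.1
        simp only [Set.indicator_of_notMem hXN, Set.indicator_of_notMem hX']
        ring
    rw [h2, integral_sub hΦζ ((hΦζ.indicator₀ hNm).const_mul _),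
      MeasureTheory.integral_const_mul, integral_indicator₀ hNm, ← restrict_discPreimage h hAm]
    have := hid ζ
    rw [← discMeasure] at this ⊢
    linarith
  rw [heq]
  calc |∫ X in closedDisc, (Ω 1 X * partialDeriv 0 ζ X - Ω 0 X * partialDeriv 1 ζ X)|
      ≤ ∫ X, C * (gradLength p X * gradLength (fun i => partialDeriv i ζ) X) ∂discMeasure := by
        rw [← Real.norm_eq_abs]
        refine norm_integral_le_of_norm_le ((hgrad.integrable_mul hζg).const_mul C) ?_
        filter_upwards [hΩle] with X hX
        have hcs : ‖p 1 X‖ * |partialDeriv 0 ζ X| + ‖p 0 X‖ * |partialDeriv 1 ζ X| ≤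
            gradLength p X * gradLength (fun i => partialDeriv i ζ) X := by
          refine abs_le_of_sq_le_sq' ?_ (mul_nonneg (gradLength_nonneg _ _)
            (gradLength_nonneg _ _)) |>.2
          rw [mul_pow, gradLength_sq, gradLength_sq, Real.norm_eq_abs, Real.norm_eq_abs]
          nlinarith [sq_nonneg (‖p 1 X‖ * |partialDeriv 1 ζ X| - ‖p 0 X‖ * |partialDeriv 0 ζ X|)]
        calc ‖Ω 1 X * partialDeriv 0 ζ X - Ω 0 X * partialDeriv 1 ζ X‖
            ≤ |Ω 1 X| * |partialDeriv 0 ζ X| + |Ω 0 X| * |partialDeriv 1 ζ X| := by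
              rw [← abs_mul, ← abs_mul]; exact norm_sub_le _ _
          _ ≤ C * ‖p 1 X‖ * |partialDeriv 0 ζ X| + C * ‖p 0 X‖ * |partialDeriv 1 ζ X| := by
              gcongr
              · exact hX 1
              · exact hX 0
          _ = C * (‖p 1 X‖ * |partialDeriv 0 ζ X| + ‖p 0 X‖ * |partialDeriv 1 ζ X|) := by ring
          _ ≤ _ := mul_le_mul_of_nonneg_left hcs hC0
    _ = C * ∫ X, gradLength p X * gradLength (fun i => partialDeriv i ζ) X ∂discMeasure :=
        MeasureTheory.integral_const_mul _ _
    _ ≤ C * (l2Norm (gradLength p) * l2Norm (gradLength fun i => partialDeriv i ζ)) :=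
        mul_le_mul_of_nonneg_left (integral_mul_le_l2Norm hgrad hζg) hC0
    _ ≤ C * (l2Norm (gradLength p) * 1) := by
        have : 0 ≤ l2Norm (gradLength p) := ENNReal.toReal_nonneg
        gcongr
    _ = _ := by rw [mul_one]
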